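/- **Setting.** Let $E$ be a (Hausdorff) CW complex with set of $i$-cells $\mathcal{E}_i$ ($\mathcal{E}_i=\emptyset$ for $i<0$), choose an orientation of every cell, and let $d_{\alpha\beta}\in\mathbb{Z}$ ($\alpha\in\mathcal{E}_{i+1}$, $\beta\in\mathcal{E}_i$) be the incidence numbers, i.e. the coefficients of the cellular boundary $\partial e_\alpha=\sum_\beta d_{\alpha\beta}e_\beta$ (equivalently, the degrees of the maps $S^i\to E^i\to S^i$ obtained from the attaching map of $\alpha$ by collapsing the complement of the open cell $\beta$). Assume that for every cell $\beta$ only finitely many $\alpha$ have $d_{\alpha\beta}\neq 0$. Let $G$ be a finite abelian group, $\hat G=\mathrm{Hom}(G,\mathbb{Q}/\mathbb{Z})$, and $n\in\mathbb{N}$. For an abelian group $M$ let $C^{\mathrm{lf}}_i(E;M)=C^i(E;M)=\prod_{\mathcal{E}_i}M$ and $C_i(E;M)=C^i_{\mathrm{lf}}(E;M)=\bigoplus_{\mathcal{E}_i}M$, with $\partial(\sum_\alpha x_\alpha e_\alpha)=\sum_\beta(\sum_\alpha d_{\alpha\beta}x_\alpha)e_\beta$ and $\partial^T(\sum_\beta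 g_\beta e_\beta)=\sum_\alpha(\sum_\beta d_{\alpha\beta}g_\beta)e_\alpha$. The homology at infinity $H^\infty_i(E;M)$ is the degree $i$ homology of the complex $C_i\oplus C^{\mathrm{lf}}_{i+1}$ with boundary $(b,d)\mapsto(-\partial b,b+\partial d)$, and the cohomology at infinity $H^i_\infty(E;M)$ is the degree $i$ cohomology of the complex $C^{i+1}_{\mathrm{lf}}\oplus C^i$ with coboundary $(a,c)\mapsto(-\partial^Ta,a+\partial^Tc)$. For $d\in C^{\mathrm{lf}}_{i+1}$ with $|\mathrm{supp}\,\partial d|<\infty$ let $[d]^\infty\in H_i^\infty$ be the class of $(-\partial d,d)$; for $c\in C^i$ with $|\mathrm{supp}\,\partial^Tc|<\infty$ let $[c]_\infty\in H^i_\infty$ be the class of $(-\partial^Tc,c)$. For a finite set $K$ of cells, $c_K$ denotes the restriction of $c$ to $K$. Let $\mathfrak{A}$ be the quasi-local C*-algebra with site set $\mathcal{E}_n$ and local Hilbert space $\ell^2(G)$, i.e. the C*-algebraic direct limit of the algebras $B(\ell^2(G)^{\otimes\Lambda})$ over the finite $\Lambda\subseteq\mathcal{E}_n$. On one site put $X^g|h\rangle=|g+h\rangle$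 and $Z^\chi|h\rangle=e^{2\pi i\chi(h)}|h\rangle$; for $a=\sum g_\alpha e_\alpha\in C^n_{\mathrm{lf}}(E;G)$ and $b=\sum\chi_\alpha e_\alpha\in C_n(E;\hat G)$ let $X^a=\prod_\alpha (X^{g_\alpha})_\alpha$ and $Z^b=\prod_\alpha (Z^{\chi_\alpha})_\alpha$ in $\mathfrak{A}$. A state $\omega$ on $\mathfrak{A}$ is an *asymptotic ground state* if for every $\varepsilon>0$ there are finite sets $K_\pm(\varepsilon)\subseteq\mathcal{E}_{n\pm1}$ such that $|\omega(X^{\partial^Tc}Z^{\partial d})-1|<\varepsilon$ for all $c\in C^{n-1}_{\mathrm{lf}}(E;G)$ and $d\in C_{n+1}(E;\hat G)$ with $\mathrm{supp}\,c\cap K_-(\varepsilon)=\emptyset=\mathrm{supp}\,d\cap K_+(\varepsilon)$. Let $\pi_\omega:\mathfrak{A}\to B(\mathcal{H}_\omega)$ be the GNS representation of $\omega$. **Theorem 7.4.** Let $\omega$ be an asymptotic ground state on $\mathfrak{A}$. 1. For all $c\in C^{n-1}(E;G)$ and $d\in C^{\mathrm{lf}}_{n+1}(E;\hat G)$ with $|\mathrm{supp}\,\partial^Tc|<\infty$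 and $|\mathrm{supp}\,\partial d|<\infty$, the limit $$\lim_{\substack{K_-\to\mathcal{E}_{n-1}\\K_+\to\mathcal{E}_{n+1}}}\pi_\omega\bigl(X^{\partial^T(c-c_{K_-})}Z^{\partial(d-d_{K_+})}\bigr)$$ along the net of finite sets $K_\pm\subseteq\mathcal{E}_{n\pm1}$ exists in the strong operator topology, and it is unitary. 2. The limit lies in $\pi_\omega(\mathfrak{A})'\cap\pi_\omega(\mathfrak{A})''$. 3. The limit depends only on $[d]^\infty\in H^\infty_n(E;\hat G)$ and $[c]_\infty\in H^{n-1}_\infty(E;G)$. 4. There is a unique group homomorphism $P_\omega$ from $H^\infty_n(E;\hat G)\times H^{n-1}_\infty(E;G)$ to the unitary group of $B(\mathcal{H}_\omega)$, with values in $\pi_\omega(\mathfrak{A})'\cap\pi_\omega(\mathfrak{A})''$, such that $P_\omega([d]^\infty,[c]_\infty)$ is the limit in 1 for all such $c$, $d$. That is, the limits define a unitary representation on $\mathcal{H}_\omega$. -/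

import Mathlib

universe u v

open CategoryTheory Topology Filter
open scoped ComplexOrder

noncomputable section

namespace CellKitaev

/-! ### Relative singular homology -/

section Singular

variable {X Y Z : Type u} [TopologicalSpace X] [TopologicalSpace Y] [TopologicalSpace Z]

/-- The singular chain complex of a space, with integer coefficients. -/
abbrev singChains (X : Type u) [TopologicalSpace X] : ChainComplex AddCommGrpCat.{u} ℕ :=
  ((AlgebraicTopology.singularChainComplexFunctor AddCommGrpCat.{u}).obj
    (AddCommGrpCat.of (ULift.{u} ℤ))).obj (TopCat.of X)

/-- The singular boundary operator from degree `i` to degree `j` (zero unless `i = j + 1`). -/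
def singD (X : Type u) [TopologicalSpace X] (i j : ℕ) :
    (singChains X).X i →+ (singChains X).X j :=
  ((singChains X).d i j).hom

/-- Push-forward of singular chains along a continuous map. -/
def push (f : C(X, Y)) (k : ℕ) : (singChains X).X k →+ (singChains Y).X k :=
  ((((AlgebraicTopology.singularChainComplexFunctor AddCommGrpCat.{u}).obj
    (AddCommGrpCat.of (ULift.{u} ℤ))).map (TopCat.ofHom f)).f k).hom

/-- The singular chains of `X` that lie in the subset `A`. -/
def chainsIn (A : Set X) (k : ℕ) : AddSubgroup ((singChains X).X k) :=
  (push (⟨Subtype.val, continuous_subtype_val⟩ : C(A, X)) k).range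

theorem singD_singD (i j k : ℕ) (x : (singChains X).X i) : singD X j k (singD X i j x) = 0 := by
  have h := (singChains X).d_comp_d i j k
  exact congrArg (fun g => g.hom x) h

theorem push_singD (f : C(X, Y)) (i j : ℕ) (x : (singChains X).X i) :
    push f j (singD X i j x) = singD Y i j (push f i x) := by
  have h := (((AlgebraicTopology.singularChainComplexFunctor AddCommGrpCat.{u}).obj
    (AddCommGrpCat.of (ULift.{u} ℤ))).map (TopCat.ofHom f)).comm i j
  exact (congrArg (fun g => g.hom x) h).symm

theorem push_push (f : C(X, Y)) (g : C(Y, Z)) (k : ℕ) (x : (singChains X).X k) :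
    push g k (push f k x) = push (g.comp f) k x := by
  unfold push
  rw [TopCat.ofHom_comp, Functor.map_comp]
  rfl

theorem push_mem_chainsIn (f : C(X, Y)) {A : Set X} {B : Set Y} (h : Set.MapsTo f A B) {k : ℕ}
    {x : (singChains X).X k} (hx : x ∈ chainsIn A k) : push f k x ∈ chainsIn B k := by
  obtain ⟨y, rfl⟩ := hx
  refine ⟨push ⟨h.restrict, f.continuous.restrict h⟩ k y, ?_⟩
  rw [push_push, push_push]
  rfl

/-- Relative cycles of the pair `(A, B)`: chains in `A` whose boundary lies in `B`. -/
def relCycles (A B : Set X) (k : ℕ) : AddSubgroup ((singChains X).X k) :=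
  chainsIn A k ⊓ ⨅ j, (chainsIn B j).comap (singD X k j)

/-- Relative boundaries of the pair `(A, B)`: chains in `B` plus boundaries of chains in `A`. -/
def relBoundaries (A B : Set X) (k : ℕ) : AddSubgroup ((singChains X).X k) :=
  chainsIn B k ⊔ (chainsIn A (k + 1)).map (singD X (k + 1) k)

/-- The relative singular homology group `H_k(A, B; ℤ)` of subsets `B ⊆ A` of a space. -/
abbrev RelHomology (A B : Set X) (k : ℕ) : Type u :=
  relCycles A B k ⧸ (relBoundaries A B k).addSubgroupOf (relCycles A B k)

theorem mem_relCycles {A B : Set X} {k : ℕ} {x : (singChains X).X k} :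
    x ∈ relCycles A B k ↔ x ∈ chainsIn A k ∧ ∀ j, singD X k j x ∈ chainsIn B j := by
  simp [relCycles, AddSubgroup.mem_inf, AddSubgroup.mem_iInf]

theorem push_mem_relCycles (f : C(X, Y)) {A B : Set X} {A' B' : Set Y} (hA : Set.MapsTo f A A')
    (hB : Set.MapsTo f B B') {k : ℕ} {x : (singChains X).X k} (hx : x ∈ relCycles A B k) :
    push f k x ∈ relCycles A' B' k := by
  rw [mem_relCycles] at hx ⊢
  refine ⟨push_mem_chainsIn f hA hx.1, fun j => ?_⟩
  rw [← push_singD]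
  exact push_mem_chainsIn f hB (hx.2 j)

theorem push_mem_relBoundaries (f : C(X, Y)) {A B : Set X} {A' B' : Set Y}
    (hA : Set.MapsTo f A A') (hB : Set.MapsTo f B B') {k : ℕ} {x : (singChains X).X k}
    (hx : x ∈ relBoundaries A B k) : push f k x ∈ relBoundaries A' B' k := by
  obtain ⟨y, hy, z, ⟨w, hw, rfl⟩, rfl⟩ := AddSubgroup.mem_sup.1 hx
  rw [map_add, push_singD]
  exact AddSubgroup.mem_sup.2 ⟨_, push_mem_chainsIn f hB hy, _,
    ⟨_, push_mem_chainsIn f hA hw, rfl⟩, rfl⟩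

/-- The map on relative homology induced by a continuous map of pairs. -/
def relMap (f : C(X, Y)) {A B : Set X} {A' B' : Set Y} (hA : Set.MapsTo f A A')
    (hB : Set.MapsTo f B B') (k : ℕ) : RelHomology A B k →+ RelHomology A' B' k :=
  QuotientAddGroup.map _ _
    (((push f k).comp (relCycles A B k).subtype).codRestrict (relCycles A' B' k)
      fun x => push_mem_relCycles f hA hB x.2)
    (fun _ hx => push_mem_relBoundaries f hA hB hx)

theorem singD_mem_relCycles {A B : Set X} (D : Set X) {k : ℕ} {x : (singChains X).X (k + 1)}
    (hx : x ∈ relCycles A B (k + 1)) : singD X (k + 1) k x ∈ relCycles B D k := by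
  rw [mem_relCycles] at hx ⊢
  refine ⟨hx.2 k, fun j => ?_⟩
  rw [singD_singD]
  exact zero_mem _

theorem singD_mem_relBoundaries {A B : Set X} (D : Set X) {k : ℕ} {x : (singChains X).X (k + 1)}
    (hx : x ∈ relBoundaries A B (k + 1)) : singD X (k + 1) k x ∈ relBoundaries B D k := by
  obtain ⟨y, hy, z, ⟨w, hw, rfl⟩, rfl⟩ := AddSubgroup.mem_sup.1 hx
  rw [map_add, singD_singD, add_zero]
  exact AddSubgroup.mem_sup_right ⟨_, hy, rfl⟩

/-- The boundary map `H_{k+1}(A, B) → H_k(B, D)` of a triple `D ⊆ B ⊆ A`. -/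
def tripleBoundary (A B D : Set X) (k : ℕ) : RelHomology A B (k + 1) →+ RelHomology B D k :=
  QuotientAddGroup.map _ _
    (((singD X (k + 1) k).comp (relCycles A B (k + 1)).subtype).codRestrict (relCycles B D k)
      fun x => singD_mem_relCycles D x.2)
    (fun _ hx => singD_mem_relBoundaries D hx)

theorem tripleBoundary_tripleBoundary (A B D F : Set X) (k : ℕ)
    (x : RelHomology A B (k + 1 + 1)) :
    tripleBoundary B D F k (tripleBoundary A B D (k + 1) x) = 0 := by
  obtain ⟨x, rfl⟩ := QuotientAddGroup.mk_surjective x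
  refine (QuotientAddGroup.eq_zero_iff _).2 ?_
  have : singD X (k + 1) k (singD X (k + 1 + 1) (k + 1) x.1) ∈ relBoundaries D F k := by
    rw [singD_singD]
    exact zero_mem _
  exact this

end Singular

/-! ### The cellular chain complex of a CW complex -/

section CW

/-- The closed unit ball of dimension `i`, the domain of the characteristic maps of `i`-cells. -/
abbrev Ball (i : ℕ) : Type u := ULift.{u} (Metric.closedBall (0 : Fin i → ℝ) 1)

/-- The boundary sphere of the closed unit ball. -/
def ballSphere (i : ℕ) : Set (Ball.{u} i) := {x | (x.down : Fin i → ℝ) ∈ Metric.sphere 0 1}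

variable {X : Type u} [TopologicalSpace X] [T2Space X] (E : Set X) [CWComplex E]

/-- The characteristic map of a cell, as a continuous map on the closed ball. -/
def charMap (i : ℕ) (α : RelCWComplex.cell E i) : C(Ball.{u} i, X) where
  toFun x := RelCWComplex.map i α x.down
  continuous_toFun :=
    (continuousOn_iff_continuous_domRestrict.1 (RelCWComplex.continuousOn i α)).comp
      continuous_uliftDown

/-- The group `H_i(E^i, E^{i-1}; ℤ)` of integral cellular `i`-chains (with `E^{-1} = ∅`). -/
abbrev CellularGroup (i : ℕ) : Type u :=
  RelHomology (X := X) (RelCWComplex.skeletonLT E (i + 1 : ℕ)) (RelCWComplex.skeletonLT E i) i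

theorem charMap_mapsTo_univ (i : ℕ) (α : RelCWComplex.cell E i) :
    Set.MapsTo (charMap E i α) Set.univ
      (RelCWComplex.skeletonLT E (i + 1 : ℕ) : Set X) := by
  intro x _
  have := RelCWComplex.closedCell_subset_skeletonLT (C := E) i α
  exact_mod_cast this (Set.mem_image_of_mem _ x.down.2)

theorem charMap_mapsTo_sphere (i : ℕ) (α : RelCWComplex.cell E i) :
    Set.MapsTo (charMap E i α) (ballSphere i) (RelCWComplex.skeletonLT E i : Set X) := by
  intro x hx
  exact RelCWComplex.cellFrontier_subset_skeletonLT (C := E) i α (Set.mem_image_of_mem _ hx)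

/-- An orientation of every cell: a generator of `H_i(D^i, S^{i-1}; ℤ) ≅ ℤ` for each `i`-cell. -/
structure CellOrientation where
  /-- the chosen fundamental class -/
  cls (i : ℕ) (α : RelCWComplex.cell E i) :
    RelHomology (Set.univ : Set (Ball.{u} i)) (ballSphere i) i
  generates (i : ℕ) (α : RelCWComplex.cell E i) : AddSubgroup.zmultiples (cls i α) = ⊤

variable {E} (o : CellOrientation E)

/-- The class `[e_α] ∈ H_i(E^i, E^{i-1}; ℤ)` of an oriented `i`-cell. -/
def cellClass (i : ℕ) (α : RelCWComplex.cell E i) : CellularGroup E i :=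
  relMap (charMap E i α) (charMap_mapsTo_univ E i α) (charMap_mapsTo_sphere E i α) i (o.cls i α)

/-- The classes of the `i`-cells form a basis of `H_i(E^i, E^{i-1}; ℤ)`. -/
def CellsFormBasis (i : ℕ) : Prop :=
  LinearIndependent ℤ (cellClass o i) ∧ ⊤ ≤ Submodule.span ℤ (Set.range (cellClass o i))

open Classical in
/-- The incidence number `d_{αβ}` of an oriented `(i+1)`-cell `α` and an oriented `i`-cell `β`: the
coefficient of `[e_β]` in the cellular boundary `∂[e_α] ∈ H_i(E^i, E^{i-1}; ℤ)`. The coordinate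
functional of `[e_β]` is the map induced by collapsing the complement of the open cell `β` in `E^i`,
so `d_{αβ}` is the degree of the map `S^i → E^i → S^i` given by the attaching map of `α` followed by
this collapse. The cells of a CW complex always form a basis of `H_i(E^i, E^{i-1}; ℤ)`, so the
`else` branch is never taken for an actual complex. -/
def incidenceNumber (i : ℕ) (α : RelCWComplex.cell E (i + 1)) (β : RelCWComplex.cell E i) : ℤ :=
  if h : CellsFormBasis o i then
    (Module.Basis.mk h.1 h.2).repr
      (tripleBoundary _ _ _ i (cellClass o (i + 1) α) : CellularGroup E i) β
  else 0

theorem incidenceNumber_finite (i : ℕ) (α : RelCWComplex.cell E (i + 1)) :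
    {β | incidenceNumber o i α β ≠ 0}.Finite := by
  by_cases h : CellsFormBasis o i
  · simp only [incidenceNumber, h, dite_true]
    exact (((Module.Basis.mk h.1 h.2).repr _).support.finite_toSet).subset
      fun _ hx => by simpa using hx
  · simp [incidenceNumber, h]

theorem incidenceNumber_sq (i : ℕ) (α : RelCWComplex.cell E (i + 1 + 1))
    (γ : RelCWComplex.cell E i) :
    ∑ᶠ β, incidenceNumber o (i + 1) α β * incidenceNumber o i β γ = 0 := by
  by_cases h : CellsFormBasis o i
  swap
  · simp [incidenceNumber, h]
  by_cases h' : CellsFormBasis o (i + 1)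
  swap
  · simp [incidenceNumber, h']
  simp only [incidenceNumber, h, h', dite_true]
  set b := Module.Basis.mk h.1 h.2
  set b' := Module.Basis.mk h'.1 h'.2
  set y : CellularGroup E (i + 1) := tripleBoundary _ _ _ (i + 1) (cellClass o (i + 1 + 1) α)
    with hydef
  have hT : (tripleBoundary _ _ _ i y : CellularGroup E i) = 0 :=
    tripleBoundary_tripleBoundary _ _ _ _ _ _
  have hy : y = (b'.repr y).sum fun β m => m • cellClass o (i + 1) β := by
    conv_lhs => rw [← b'.linearCombination_repr y]
    simp [Finsupp.linearCombination_apply, b']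
  have hs : (b.repr (tripleBoundary _ _ _ i y : CellularGroup E i)) γ = 0 := by rw [hT]; simp
  rw [hy] at hs
  rw [finsum_eq_sum_of_support_subset (s := (b'.repr y).support)]
  · rw [Finsupp.sum, map_sum, map_sum, Finsupp.finsetSum_apply] at hs
    rw [← hs]
    refine Finset.sum_congr rfl fun β _ => ?_
    rw [map_zsmul, map_zsmul]
    rfl
  · intro β hβ
    simp only [Function.mem_support, ne_eq, mul_eq_zero, not_or] at hβ
    simpa using hβ.1

end CW

/-! ### Chains, cochains, and (co)homology at infinity -/

/-- The combinatorial data of a cell complex: cells with their dimensions and incidence numbers. It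
is only used through `cellularData` below, where all fields are constructed and proved for a CW
complex. -/
structure CellularData where
  /-- all cells -/
  Cell : Type u
  /-- the dimension of a cell -/
  dim : Cell → ℕ
  /-- the incidence numbers -/
  inc : Cell → Cell → ℤ
  dim_eq : ∀ a b, inc a b ≠ 0 → dim a = dim b + 1
  finite_bdry : ∀ a, {b | inc a b ≠ 0}.Finite
  finite_cobdry : ∀ b, {a | inc a b ≠ 0}.Finite
  inc_sq : ∀ a c, ∑ᶠ b, inc a b * inc b c = 0

section OfCW

variable {X : Type u} [TopologicalSpace X] [T2Space X] {E : Set X} [CWComplex E]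
  (o : CellOrientation E)

open Classical in
/-- The incidence number of two cells of arbitrary dimensions (zero unless the dimensions are
consecutive). -/
def sigmaInc (a b : Σ i, RelCWComplex.cell E i) : ℤ :=
  if h : a.1 = b.1 + 1 then incidenceNumber o b.1 (h ▸ a.2) b.2 else 0

theorem sigmaInc_succ (i : ℕ) (α : RelCWComplex.cell E (i + 1)) (β : RelCWComplex.cell E i) :
    sigmaInc o ⟨i + 1, α⟩ ⟨i, β⟩ = incidenceNumber o i α β := by
  simp [sigmaInc]

theorem sigmaInc_dim (a b : Σ i, RelCWComplex.cell E i) (h : sigmaInc o a b ≠ 0) :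
    a.1 = b.1 + 1 := by
  by_contra hne
  exact h (by simp [sigmaInc, hne])

theorem sigmaInc_finite_bdry (a : Σ i, RelCWComplex.cell E i) :
    {b | sigmaInc o a b ≠ 0}.Finite := by
  obtain ⟨_ | i, α⟩ := a
  · convert Set.finite_empty
    ext b
    simp only [Set.mem_ofPred_eq, Set.mem_empty_iff_false, iff_false]
    exact fun h => absurd (sigmaInc_dim o _ _ h) (by simp)
  · refine ((incidenceNumber_finite o i α).image (Sigma.mk i)).subset ?_
    rintro ⟨j, β⟩ h
    obtain rfl : j = i := by have := sigmaInc_dim o _ _ h; simp at this; omega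
    exact ⟨β, by simpa [sigmaInc_succ] using h, rfl⟩

theorem sigmaInc_sq (a c : Σ i, RelCWComplex.cell E i) :
    ∑ᶠ b, sigmaInc o a b * sigmaInc o b c = 0 := by
  by_cases h : a.1 = c.1 + 1 + 1
  · obtain ⟨i, γ⟩ := c
    obtain ⟨k, α⟩ := a
    obtain rfl : k = i + 1 + 1 := h
    have hr : ∀ b, sigmaInc o ⟨i + 1 + 1, α⟩ b * sigmaInc o b ⟨i, γ⟩ ≠ 0 →
        b ∈ Set.range (Sigma.mk (β := RelCWComplex.cell E) (i + 1)) := by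
      rintro ⟨j, β⟩ hb
      obtain rfl : j = i + 1 := sigmaInc_dim o _ _ (right_ne_zero_of_mul hb)
      exact ⟨β, rfl⟩
    rw [← finsum_mem_univ, finsum_mem_inter_support_eq _ _ (Set.range (Sigma.mk (i + 1))),
      finsum_mem_range sigma_mk_injective]
    · simp only [sigmaInc_succ]
      exact incidenceNumber_sq o i α γ
    · ext b
      simp only [Set.univ_inter, Set.mem_inter_iff, Function.mem_support]
      exact ⟨fun hb => ⟨hr b hb, hb⟩, fun hb => hb.2⟩
  · rw [finsum_eq_zero_of_forall_eq_zero]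
    intro b
    by_contra hb
    have h1 := sigmaInc_dim o _ _ (left_ne_zero_of_mul hb)
    have h2 := sigmaInc_dim o _ _ (right_ne_zero_of_mul hb)
    omega

/-- Every cell has a nonzero incidence number with only finitely many cells of the next
dimension. -/
def IsLocallyFinite : Prop :=
  ∀ (i : ℕ) (β : RelCWComplex.cell E i), {α | incidenceNumber o i α β ≠ 0}.Finite

/-- The cells of an oriented CW complex with their incidence numbers. -/
def cellularData (hfin : IsLocallyFinite o) : CellularData.{u} where
  Cell := Σ i, RelCWComplex.cell E i
  dim := Sigma.fst
  inc := sigmaInc o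
  dim_eq := sigmaInc_dim o
  finite_bdry := sigmaInc_finite_bdry o
  finite_cobdry := by
    rintro ⟨i, β⟩
    refine ((hfin i β).image (Sigma.mk (i + 1))).subset ?_
    rintro ⟨j, α⟩ h
    obtain rfl : j = i + 1 := sigmaInc_dim o _ _ h
    exact ⟨α, by simpa [sigmaInc_succ] using h, rfl⟩
  inc_sq := sigmaInc_sq o

end OfCW

namespace CellularData

variable (K : CellularData.{u}) (M : Type v) [AddCommGroup M]

/-- The cells of dimension `p` (there are none if `p < 0`). -/
abbrev cells (p : ℤ) : Type u := {a : K.Cell // (K.dim a : ℤ) = p}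

/-- Formal, possibly infinite, sums of `p`-cells with coefficients in `M`: these are both the
locally finite `p`-chains and the `p`-cochains. -/
def infChains (p : ℤ) : AddSubgroup (K.Cell → M) where
  carrier := {f | ∀ a, f a ≠ 0 → (K.dim a : ℤ) = p}
  zero_mem' := by simp
  add_mem' {f g} hf hg a h := by
    by_cases h0 : f a = 0
    · exact hg a fun h1 => h (by simp [h0, h1])
    · exact hf a h0
  neg_mem' {f} hf a h := hf a (by simpa using h)

/-- Finite formal sums of `p`-cells with coefficients in `M`: these are both the `p`-chains and
the locally finite `p`-cochains. -/
def finChains (p : ℤ) : AddSubgroup (K.Cell → M) where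
  carrier := {f | f ∈ K.infChains M p ∧ f.support.Finite}
  zero_mem' := ⟨zero_mem _, by simp⟩
  add_mem' {f g} hf hg :=
    ⟨add_mem hf.1 hg.1, (hf.2.union hg.2).subset (Function.support_add f g)⟩
  neg_mem' {f} hf := ⟨neg_mem hf.1, by simpa [Function.support_neg] using hf.2⟩

variable {M}

theorem finite_support_bdry (f : K.Cell → M) (b : K.Cell) :
    (Function.support fun a => K.inc a b • f a).Finite :=
  (K.finite_cobdry b).subset fun a ha h => ha (by simp [h])

theorem finite_support_cobdry (f : K.Cell → M) (a : K.Cell) :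
    (Function.support fun b => K.inc a b • f b).Finite :=
  (K.finite_bdry a).subset fun b hb h => hb (by simp [h])

/-- The boundary map `∂ (∑ x_α e_α) = ∑_β (∑_α d_{αβ} x_α) e_β`. -/
def bdry : (K.Cell → M) →+ (K.Cell → M) where
  toFun f b := ∑ᶠ a, K.inc a b • f a
  map_zero' := by ext; simp
  map_add' f g := by
    ext b
    simp only [Pi.add_apply, smul_add]
    exact finsum_add_distrib (K.finite_support_bdry f b) (K.finite_support_bdry g b)

/-- The coboundary map `∂ᵀ (∑ g_β e_β) = ∑_α (∑_β d_{αβ} g_β) e_α`. -/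
def cobdry : (K.Cell → M) →+ (K.Cell → M) where
  toFun f a := ∑ᶠ b, K.inc a b • f b
  map_zero' := by ext; simp
  map_add' f g := by
    ext a
    simp only [Pi.add_apply, smul_add]
    exact finsum_add_distrib (K.finite_support_cobdry f a) (K.finite_support_cobdry g a)

theorem bdry_bdry (f : K.Cell → M) : K.bdry (K.bdry f) = 0 := by
  classical
  ext c
  set B := (K.finite_cobdry c).toFinset
  set A := B.biUnion fun b => (K.finite_cobdry b).toFinset
  have h1 : ∀ b ∈ B, (∑ᶠ a, K.inc a b • f a) = ∑ a ∈ A, K.inc a b • f a := by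
    intro b hb
    refine finsum_eq_sum_of_support_subset _ fun a ha => ?_
    simp only [A, Finset.coe_biUnion, Set.mem_iUnion, Set.Finite.coe_toFinset, Finset.mem_coe]
    exact ⟨b, hb, fun h => ha (by simp [h])⟩
  have h2 : ∀ a, ∑ b ∈ B, K.inc a b * K.inc b c = 0 := by
    intro a
    rw [← K.inc_sq a c]
    refine (finsum_eq_sum_of_support_subset _ fun b hb => ?_).symm
    simpa [B] using right_ne_zero_of_mul hb
  change ∑ᶠ b, K.inc b c • (∑ᶠ a, K.inc a b • f a) = 0
  rw [finsum_eq_sum_of_support_subset (s := B) _ fun b hb => by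
    simpa [B] using fun h => hb (by simp [h])]
  rw [Finset.sum_congr rfl fun b hb => by rw [h1 b hb, Finset.smul_sum], Finset.sum_comm]
  refine Finset.sum_eq_zero fun a _ => ?_
  have : ∑ b ∈ B, K.inc b c • K.inc a b • f a = (∑ b ∈ B, K.inc a b * K.inc b c) • f a := by
    rw [Finset.sum_smul]
    exact Finset.sum_congr rfl fun b _ => by rw [smul_smul, mul_comm]
  rw [this, h2, zero_smul]

theorem cobdry_cobdry (f : K.Cell → M) : K.cobdry (K.cobdry f) = 0 := by
  classical
  ext a
  set B := (K.finite_bdry a).toFinset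
  set C := B.biUnion fun b => (K.finite_bdry b).toFinset
  have h1 : ∀ b ∈ B, (∑ᶠ c, K.inc b c • f c) = ∑ c ∈ C, K.inc b c • f c := by
    intro b hb
    refine finsum_eq_sum_of_support_subset _ fun c hc => ?_
    simp only [C, Finset.coe_biUnion, Set.mem_iUnion, Set.Finite.coe_toFinset, Finset.mem_coe]
    exact ⟨b, hb, fun h => hc (by simp [h])⟩
  have h2 : ∀ c, ∑ b ∈ B, K.inc a b * K.inc b c = 0 := by
    intro c
    rw [← K.inc_sq a c]
    refine (finsum_eq_sum_of_support_subset _ fun b hb => ?_).symm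
    simpa [B] using left_ne_zero_of_mul hb
  change ∑ᶠ b, K.inc a b • (∑ᶠ c, K.inc b c • f c) = 0
  rw [finsum_eq_sum_of_support_subset (s := B) _ fun b hb => by
    simpa [B] using fun h => hb (by simp [h])]
  rw [Finset.sum_congr rfl fun b hb => by rw [h1 b hb, Finset.smul_sum], Finset.sum_comm]
  refine Finset.sum_eq_zero fun c _ => ?_
  have : ∑ b ∈ B, K.inc a b • K.inc b c • f c = (∑ b ∈ B, K.inc a b * K.inc b c) • f c := by
    rw [Finset.sum_smul]
    exact Finset.sum_congr rfl fun b _ => by rw [smul_smul]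
  rw [this, h2, zero_smul]

theorem bdry_mem_infChains {p : ℤ} {f : K.Cell → M} (hf : f ∈ K.infChains M (p + 1)) :
    K.bdry f ∈ K.infChains M p := by
  intro b hb
  by_contra hne
  refine hb (finsum_eq_zero_of_forall_eq_zero fun a => ?_)
  by_contra h
  have h1 := K.dim_eq a b fun h0 => h (by simp [h0])
  have h2 := hf a fun h0 => h (by simp [h0])
  omega

theorem cobdry_mem_infChains {p : ℤ} {f : K.Cell → M} (hf : f ∈ K.infChains M p) :
    K.cobdry f ∈ K.infChains M (p + 1) := by
  intro a ha
  by_contra hne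
  refine ha (finsum_eq_zero_of_forall_eq_zero fun b => ?_)
  by_contra h
  have h1 := K.dim_eq a b fun h0 => h (by simp [h0])
  have h2 := hf b fun h0 => h (by simp [h0])
  omega

/-- The boundary map `(b, d) ↦ (-∂b, b + ∂d)` of the algebraic mapping cone of the inclusion of
the chains into the locally finite chains. -/
def coneBdry : (K.Cell → M) × (K.Cell → M) →+ (K.Cell → M) × (K.Cell → M) :=
  (-(K.bdry.comp (AddMonoidHom.fst _ _))).prod
    (AddMonoidHom.fst _ _ + K.bdry.comp (AddMonoidHom.snd _ _))

/-- The coboundary map `(a, c) ↦ (-∂ᵀa, a + ∂ᵀc)` of the algebraic mapping cone of the inclusion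
of the locally finite cochains into the cochains. -/
def coneCobdry : (K.Cell → M) × (K.Cell → M) →+ (K.Cell → M) × (K.Cell → M) :=
  (-(K.cobdry.comp (AddMonoidHom.fst _ _))).prod
    (AddMonoidHom.fst _ _ + K.cobdry.comp (AddMonoidHom.snd _ _))

variable (M)

/-- The cone chains `C_n ⊕ C^lf_{n+1}`, in degree `n` (after the shift of the cone by one). -/
def coneChains (n : ℤ) : AddSubgroup ((K.Cell → M) × (K.Cell → M)) :=
  (K.finChains M n).prod (K.infChains M (n + 1))

/-- The cone cochains `C_lf^{n+1} ⊕ C^n`, in degree `n`. -/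
def coneCochains (n : ℤ) : AddSubgroup ((K.Cell → M) × (K.Cell → M)) :=
  (K.finChains M (n + 1)).prod (K.infChains M n)

/-- The `n`-cycles at infinity. -/
def cyclesAtInfty (n : ℤ) : AddSubgroup ((K.Cell → M) × (K.Cell → M)) :=
  K.coneChains M n ⊓ K.coneBdry.ker

/-- The `n`-cocycles at infinity. -/
def cocyclesAtInfty (n : ℤ) : AddSubgroup ((K.Cell → M) × (K.Cell → M)) :=
  K.coneCochains M n ⊓ K.coneCobdry.ker

/-- The homology group at infinity `H^∞_n(E; M)`. -/
abbrev HomologyAtInfty (n : ℤ) : Type (max u v) :=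
  K.cyclesAtInfty M n ⧸
    ((K.coneChains M (n + 1)).map K.coneBdry).addSubgroupOf (K.cyclesAtInfty M n)

/-- The cohomology group at infinity `H_∞^n(E; M)`. -/
abbrev CohomologyAtInfty (n : ℤ) : Type (max u v) :=
  K.cocyclesAtInfty M n ⧸
    ((K.coneCochains M (n - 1)).map K.coneCobdry).addSubgroupOf (K.cocyclesAtInfty M n)

variable {M}

/-- The class `[d]^∞ ∈ H^∞_n(E; M)` of a locally finite `(n+1)`-chain `d` with finite boundary: it
is represented by `(-∂d, d)`. -/
def homClass (n : ℤ) (d : K.Cell → M) (hd : d ∈ K.infChains M (n + 1))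
    (hfin : (K.bdry d).support.Finite) : K.HomologyAtInfty M n :=
  QuotientAddGroup.mk ⟨(-K.bdry d, d),
    ⟨⟨(K.finChains M n).neg_mem ⟨K.bdry_mem_infChains hd, hfin⟩, hd⟩, by
      change (-K.bdry (-K.bdry d), -K.bdry d + K.bdry d) = 0
      rw [map_neg, K.bdry_bdry]
      simp⟩⟩

/-- The class `[c]_∞ ∈ H_∞^n(E; M)` of an `n`-cochain `c` with finite coboundary: it is
represented by `(-∂ᵀc, c)`. -/
def cohomClass (n : ℤ) (c : K.Cell → M) (hc : c ∈ K.infChains M n)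
    (hfin : (K.cobdry c).support.Finite) : K.CohomologyAtInfty M n :=
  QuotientAddGroup.mk ⟨(-K.cobdry c, c),
    ⟨⟨(K.finChains M (n + 1)).neg_mem ⟨K.cobdry_mem_infChains hc, hfin⟩, hc⟩, by
      change (-K.cobdry (-K.cobdry c), -K.cobdry c + K.cobdry c) = 0
      rw [map_neg, K.cobdry_cobdry]
      simp⟩⟩

/-- The restriction `f_S` of a formal sum of cells to a finite set `S` of cells of dimension `p`. -/
def truncate {p : ℤ} (S : Finset (K.cells p)) (f : K.Cell → M) : K.Cell → M :=
  Set.indicator (Subtype.val '' (S : Set (K.cells p))) f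

end CellularData

/-! ### The quasi-local algebra and the Pauli operators -/

/-- The homomorphism `x ↦ e^{2πix}` from `ℚ/ℤ` to the unit circle. -/
def expQZ (x : AddCircle (1 : ℚ)) : Circle :=
  AddCircle.toCircle (QuotientAddGroup.map (AddSubgroup.zmultiples (1 : ℚ))
    (AddSubgroup.zmultiples (1 : ℝ)) (Rat.castHom ℝ).toAddMonoidHom (by simp) x : AddCircle (1 : ℝ))

/-- The dual group `Ĝ = Hom(G, ℚ/ℤ)`. -/
abbrev DualGroup (G : Type v) [AddCommGroup G] : Type v := G →+ AddCircle (1 : ℚ)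

section Algebra

variable (S : Type u) (G : Type v) [AddCommGroup G]

/-- The Hilbert space with orthonormal basis `|σ⟩`, where `σ` runs over the finitely supported
configurations `S → G`: the tensor product of the `ℓ²(G)` over all sites in `S` along the reference
vectors `|0⟩`. The quasi-local algebra is represented faithfully on it. -/
abbrev ConfigSpace : Type (max u v) := lp (fun _ : S →₀ G => ℂ) 2

variable {S G}

/-- The basis vector `|σ⟩`. -/
def ket (σ : S →₀ G) : ConfigSpace S G := by
  classical exact lp.single 2 σ (1 : ℂ)

theorem ket_apply (σ τ : S →₀ G) [Decidable (τ = σ)] : ket σ τ = if τ = σ then 1 else 0 := by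
  classical
  by_cases h : τ = σ
  · subst h; simp [ket]
  · simp [ket, h, lp.single_apply]

open Classical in
/-- The local algebra `𝔄_Λ = B(ℓ²(G)^{⊗Λ})` of a finite set `Λ` of sites: the operators of the form
`M ⊗ 1`, where `M` is a matrix indexed by the configurations `Λ → G`. -/
def localAlgebra (Λ : Finset S) : Set (ConfigSpace S G →L[ℂ] ConfigSpace S G) :=
  {T | ∃ M : Matrix (Λ → G) (Λ → G) ℂ, ∀ σ τ : S →₀ G,
    T (ket τ) σ = if ∀ s ∉ Λ, σ s = τ s then M (fun s => σ s) (fun s => τ s) else 0}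

variable (S G) in
/-- The quasi-local algebra `𝔄_S`, the norm closure of the algebra of local operators, as a
C*-subalgebra of the bounded operators. Since each `𝔄_Λ` is a full matrix algebra, this is the
C*-algebraic direct limit of the `𝔄_Λ`. -/
def quasiLocal : StarSubalgebra ℂ (ConfigSpace S G →L[ℂ] ConfigSpace S G) :=
  (StarAlgebra.adjoin ℂ (⋃ Λ : Finset S, localAlgebra Λ)).topologicalClosure

variable (S G) in
/-- The quasi-local algebra as a type. -/
def QuasiLocal : Type (max u v) := quasiLocal S G

instance : IsClosed (quasiLocal S G : Set (ConfigSpace S G →L[ℂ] ConfigSpace S G)) :=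
  StarSubalgebra.isClosed_topologicalClosure _

instance : CStarAlgebra (QuasiLocal S G) :=
  inferInstanceAs (CStarAlgebra (quasiLocal S G))

/-- The order of the C*-algebra `𝔄`: the positive elements are those of the form `A*A`. -/
instance : PartialOrder (QuasiLocal S G) := CStarAlgebra.spectralOrder _

instance : StarOrderedRing (QuasiLocal S G) := CStarAlgebra.spectralOrderedRing _

theorem memℓp_comp {ι : Type*} (e : ι ≃ ι) (θ : ι → Circle) (f : lp (fun _ : ι => ℂ) 2) :
    Memℓp (fun i => (θ i : ℂ) * f (e i)) 2 := by
  rw [memℓp_gen_iff (by norm_num)]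
  have h := (memℓp_gen_iff (p := 2) (by norm_num)).1 (lp.memℓp f)
  refine ((e.summable_iff).2 h).congr fun i => ?_
  rw [Function.comp_apply, norm_mul, Circle.norm_coe, one_mul]

/-- The unitary operator `f ↦ (σ ↦ θ(σ) f(e σ))` for a permutation `e` and phases `θ`. -/
def monomialOp {ι : Type*} (e : ι ≃ ι) (θ : ι → Circle) :
    lp (fun _ : ι => ℂ) 2 →L[ℂ] lp (fun _ : ι => ℂ) 2 :=
  LinearMap.mkContinuous
    { toFun := fun f => ⟨fun i => (θ i : ℂ) * f (e i), memℓp_comp e θ f⟩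
      map_add' := fun f g => by ext i; exact mul_add _ _ _
      map_smul' := fun c f => by ext i; exact mul_left_comm _ _ _ }
    1
    (fun f => by
      rw [one_mul]
      refine le_of_eq ?_
      rw [lp.norm_eq_tsum_rpow (by norm_num), lp.norm_eq_tsum_rpow (by norm_num)]
      congr 1
      rw [← e.tsum_eq fun i => ‖f i‖ ^ (2 : ENNReal).toReal]
      refine tsum_congr fun i => congrArg (· ^ _) ?_
      change ‖(θ i : ℂ) * f (e i)‖ = ‖f (e i)‖
      rw [norm_mul, Circle.norm_coe, one_mul])

theorem monomialOp_apply {ι : Type*} (e : ι ≃ ι) (θ : ι → Circle) (f : lp (fun _ : ι => ℂ) 2)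
    (i : ι) : monomialOp e θ f i = (θ i : ℂ) * f (e i) := rfl

theorem mem_quasiLocal {Λ : Finset S} {T : ConfigSpace S G →L[ℂ] ConfigSpace S G}
    (hT : T ∈ localAlgebra Λ) : T ∈ quasiLocal S G :=
  StarSubalgebra.le_topologicalClosure _
    (StarAlgebra.subset_adjoin ℂ _ (Set.mem_iUnion.2 ⟨Λ, hT⟩))

/-- The operator `X^a |σ⟩ = |a + σ⟩`. -/
def pauliX (a : S →₀ G) : QuasiLocal S G :=
  ⟨monomialOp (Equiv.subRight a) 1, mem_quasiLocal (Λ := a.support) (by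
    classical
    refine ⟨fun σ τ => if ∀ s, σ s = a s + τ s then 1 else 0, fun σ τ => ?_⟩
    rw [monomialOp_apply, ket_apply]
    have key : σ - a = τ ↔ (∀ s ∉ a.support, σ s = τ s) ∧
        ∀ s : a.support, σ s = a s + τ s := by
      rw [sub_eq_iff_eq_add', DFunLike.ext_iff]
      constructor
      · intro h
        exact ⟨fun s hs => by simpa [Finsupp.notMem_support_iff.1 hs] using h s,
          fun s => by simpa using h s⟩
      · rintro ⟨h1, h2⟩ s
        by_cases hs : s ∈ a.support
        · simpa using h2 ⟨s, hs⟩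
        · simpa [Finsupp.notMem_support_iff.1 hs] using h1 s hs
    simp only [Equiv.subRight_apply, key, Pi.one_apply, Circle.coe_one, one_mul, ite_and])⟩

/-- The operator `Z^b |σ⟩ = ∏_s χ_s(σ_s) |σ⟩` for `b = ∑ χ_s e_s`, with characters `χ_s` regarded
as complex valued through `x ↦ e^{2πix}`. -/
def pauliZ (b : S →₀ DualGroup G) : QuasiLocal S G :=
  ⟨monomialOp (Equiv.refl _) (fun σ => expQZ (b.sum fun s χ => χ (σ s))),
    mem_quasiLocal (Λ := b.support) (by
      classical
      refine ⟨fun σ τ => if σ = τ then (expQZ (∑ s : b.support, b s (σ s)) : ℂ) else 0,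
        fun σ τ => ?_⟩
      rw [monomialOp_apply, ket_apply]
      have key : σ = τ ↔ (∀ s ∉ b.support, σ s = τ s) ∧
          (fun s : b.support => σ s) = fun s : b.support => τ s := by
        rw [DFunLike.ext_iff, funext_iff]
        constructor
        · intro h
          exact ⟨fun s _ => h s, fun s => h s⟩
        · rintro ⟨h1, h2⟩ s
          by_cases hs : s ∈ b.support
          · exact h2 ⟨s, hs⟩
          · exact h1 s hs
      have hsum : (b.sum fun s χ => χ (σ s)) = ∑ s : b.support, b s (σ s) := by
        rw [Finsupp.sum, ← Finset.sum_coe_sort]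
      simp only [Equiv.refl_apply, key, hsum, mul_ite, mul_one, mul_zero, ite_and])⟩

end Algebra

/-- A function of finite support, as an element of the free module (it is only applied to
functions of finite support, and the value is `0` otherwise). -/
def toFinsupp {S M : Type*} [AddCommGroup M] (f : S → M) : S →₀ M := by
  classical exact if h : f.support.Finite then Finsupp.ofSupportFinite f h else 0

/-! ### The model, asymptotic ground states, and the truncated operators -/

section Model

variable (K : CellularData.{u}) (G : Type v) [AddCommGroup G] (n : ℕ)

/-- The quasi-local algebra `𝔄` of the model: the sites are the `n`-cells. -/
abbrev ModelAlgebra : Type (max u v) := QuasiLocal (K.cells n) G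

variable {K G}

/-- The operator `X^a` for a finite formal sum `a = ∑ g_α e_α` of `n`-cells. -/
def opX (a : K.Cell → G) : ModelAlgebra K G n := pauliX (toFinsupp fun s : K.cells n => a s)

/-- The operator `Z^b` for a finite formal sum `b = ∑ χ_α e_α` of `n`-cells. -/
def opZ (b : K.Cell → DualGroup G) : ModelAlgebra K G n :=
  pauliZ (toFinsupp fun s : K.cells n => b s)

variable {n}

/-- A state on the model algebra: a positive linear functional with `ω(1) = 1`. -/
def IsState (ω : ModelAlgebra K G n →ₚ[ℂ] ℂ) : Prop := ω 1 = 1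

/-- `ω` is an asymptotic ground state. -/
def IsAsymptoticGroundState (ω : ModelAlgebra K G n →ₚ[ℂ] ℂ) : Prop :=
  IsState ω ∧ ∀ ε > (0 : ℝ), ∃ (Km : Finset (K.cells (n - 1))) (Kp : Finset (K.cells (n + 1))),
    ∀ c ∈ K.finChains G (n - 1), ∀ d ∈ K.finChains (DualGroup G) (n + 1),
      (∀ α ∈ Km, c α = 0) → (∀ β ∈ Kp, d β = 0) →
        ‖ω (opX n (K.cobdry c) * opZ n (K.bdry d)) - 1‖ < ε

/-- The center `π(𝔄)' ∩ π(𝔄)''` of the von Neumann algebra generated by the GNS representation. -/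
def gnsCenter (ω : ModelAlgebra K G n →ₚ[ℂ] ℂ) : Set (ω.GNS →L[ℂ] ω.GNS) :=
  Set.centralizer (Set.range ω.gnsStarAlgHom) ∩
    Set.centralizer (Set.centralizer (Set.range ω.gnsStarAlgHom))

/-- `U` is the limit in the strong operator topology of
`π_ω(X^{∂ᵀ(c - c_{K₋})} Z^{∂(d - d_{K₊})})` along the net of finite sets `K₋` of `(n-1)`-cells and
`K₊` of `(n+1)`-cells. -/
def IsPolarizationLimit (ω : ModelAlgebra K G n →ₚ[ℂ] ℂ) (c : K.Cell → G) (d : K.Cell → DualGroup G)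
    (U : ω.GNS →L[ℂ] ω.GNS) : Prop :=
  ∀ v : ω.GNS, Tendsto
    (fun k : Finset (K.cells (n - 1)) × Finset (K.cells (n + 1)) =>
      ω.gnsStarAlgHom (opX n (K.cobdry (c - K.truncate k.1 c)) *
        opZ n (K.bdry (d - K.truncate k.2 d))) v)
    atTop (𝓝 (U v))

end Model

end CellKitaev

end

open CellKitaev

/-! Write u_k for the operator X^{∂ᵀc'} Z^{∂d'} attached to the tails c' = c - c_{K₋}, d' = d -
d_{K₊}. Three facts about this net of unitaries carry the proof.

It is asymptotically central (`tendsto_commutator_fluxOp_tail`): by local finiteness, the tails'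
boundary and coboundary eventually miss any given finite set of sites. Thus u_k commutes exactly
with each local algebra from some k on, and its commutator with every element of the norm closure
tends to zero.

It is Cauchy on the cyclic vector Ω (`tendsto_state_fluxOp_tail`). The pairing of ∂d with ∂ᵀc is
that of ∂∂d with c and hence zero, so the X and Z factors commute and the operators multiply as the
pairs (c, d) add. Hence u_k* u_l belongs to a difference of two tails, which is a finite chain far
away, and the ground state condition says ω(u_k* u_l) → 1. Asymptotic centrality carries the Cauchy
property from Ω to π(a)Ω, and density carries it to all vectors. The adjoints u_k* are the operators
of (-c, -d) and converge as well, so the limit is unitary; it commutes with π(𝔄) and lies in the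
strongly closed bicommutant.

It tends to 1 on boundaries at infinity (`tendsto_state_fluxOp_tail_of_boundary`). If c = a + ∂ᵀf
and d = b + ∂e with a, b finite, then f and e may be replaced by finite chains agreeing with them
near K±(ε), without changing u_k because ∂ᵀ∂ᵀ = 0 and ∂∂ = 0. So ω(u_k) → 1; the limit fixes Ω, and
being central it is the identity (`gns_limit_eq_one`). Additivity then gives both independence of
representatives and the homomorphism property. -/

noncomputable section

namespace CellKitaev

/-! ### Strong limits of asymptotically central unitaries in the GNS representation -/

section GNS

variable {A : Type*} [CStarAlgebra A] [PartialOrder A] [StarOrderedRing A] (ω : A →ₚ[ℂ] ℂ)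
  {ι : Type*} {l : Filter ι}

/-- The vector `π_ω(a)Ω` of the GNS space. -/
def gnsVec (a : A) : ω.GNS := (ω.toPreGNS a : ω.GNS)

theorem gns_gnsVec (a b : A) : ω.gnsStarAlgHom a (gnsVec ω b) = gnsVec ω (a * b) := by
  change ω.gnsNonUnitalStarAlgHom a (ω.toPreGNS b : ω.GNS) = _
  rw [ω.gnsNonUnitalStarAlgHom_apply_coe]
  rfl

theorem gns_gnsVec_one (a : A) : ω.gnsStarAlgHom a (gnsVec ω 1) = gnsVec ω a := by
  rw [gns_gnsVec, mul_one]

theorem denseRange_gnsVec : DenseRange (gnsVec ω) :=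
  UniformSpace.Completion.denseRange_coe.comp ω.toPreGNS.surjective.denseRange
    (UniformSpace.Completion.continuous_coe _)

theorem gnsVec_sub (a b : A) : gnsVec ω (a - b) = gnsVec ω a - gnsVec ω b := by
  rw [← gns_gnsVec_one, map_sub, sub_apply, gns_gnsVec_one, gns_gnsVec_one]

theorem norm_gnsVec_sq (a : A) : ((‖gnsVec ω a‖ ^ 2 : ℝ) : ℂ) = ω (star a * a) := by
  rw [gnsVec, UniformSpace.Completion.norm_coe]
  exact_mod_cast ω.preGNS_norm_sq (ω.toPreGNS a)

theorem norm_gns_apply_le (a : A) (v : ω.GNS) : ‖ω.gnsStarAlgHom a v‖ ≤ ‖a‖ * ‖v‖ :=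
  ((ω.gnsStarAlgHom a).le_opNorm v).trans
    (mul_le_mul_of_nonneg_right (NonUnitalStarAlgHom.norm_apply_le _ a) (norm_nonneg v))

theorem norm_gns_apply_of_unitary {u : A} (hu : u ∈ unitary A) (v : ω.GNS) :
    ‖ω.gnsStarAlgHom u v‖ = ‖v‖ :=
  Unitary.norm_map ⟨ω.gnsStarAlgHom u, Unitary.map_mem ω.gnsStarAlgHom hu⟩ v

/-- Expanding the square gives 2 - ω(u*w) - ω(w*u). This turns control of expectation values into
norm control on the cyclic vector. -/
theorem norm_gnsVec_sub_sq_le (hω : ω 1 = 1) {u w : A} (hu : u ∈ unitary A) (hw : w ∈ unitary A) :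
    ‖gnsVec ω u - gnsVec ω w‖ ^ 2 ≤ ‖ω (star u * w) - 1‖ + ‖ω (star w * u) - 1‖ := by
  have h := norm_gnsVec_sq ω (u - w)
  have h2 : star (u - w) * (u - w) = (1 - star u * w) + (1 - star w * u) := by
    rw [star_sub, sub_mul, mul_sub, mul_sub, Unitary.star_mul_self_of_mem hu,
      Unitary.star_mul_self_of_mem hw]
    abel
  rw [h2, map_add, map_sub, map_sub, hω, gnsVec_sub] at h
  have h3 := congrArg norm h
  rw [Complex.norm_real, Real.norm_of_nonneg (by positivity)] at h3
  rw [h3]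
  refine (norm_add_le _ _).trans ?_
  rw [norm_sub_rev, norm_sub_rev (1 : ℂ)]

variable {ω}

/-- On Ω this is the preceding estimate; on π(a)Ω one moves u past a at the cost of a vanishing
commutator; density and the isometry of π(u) give all vectors. -/
theorem cauchy_map_gns [l.NeBot] (hω : ω 1 = 1) {u : ι → A} (hu : ∀ i, u i ∈ unitary A)
    (hcomm : ∀ a, Tendsto (fun i => u i * a - a * u i) l (𝓝 0))
    (hc : Tendsto (fun p : ι × ι => ω (star (u p.1) * u p.2)) (l ×ˢ l) (𝓝 1)) (v : ω.GNS) :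
    Cauchy (map (fun i => ω.gnsStarAlgHom (u i) v) l) := by
  rw [cauchy_map_iff, uniformity_eq_comap_nhds_zero, tendsto_comap_iff]
  refine ⟨inferInstance, ?_⟩
  change Tendsto (fun p : ι × ι => ω.gnsStarAlgHom (u p.2) v - ω.gnsStarAlgHom (u p.1) v) _ _
  have hΩ : Tendsto (fun p : ι × ι => gnsVec ω (u p.2) - gnsVec ω (u p.1)) (l ×ˢ l) (𝓝 0) := by
    have h1 : Tendsto (fun p : ι × ι => ‖ω (star (u p.1) * u p.2) - 1‖) (l ×ˢ l) (𝓝 0) := by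
      simpa using (hc.sub_const 1).norm
    have h2 := h1.comp (tendsto_snd.prodMk tendsto_fst : Tendsto Prod.swap (l ×ˢ l) (l ×ˢ l))
    simp only [Function.comp_def] at h2
    have h3 : Tendsto (fun p : ι × ι => ‖gnsVec ω (u p.2) - gnsVec ω (u p.1)‖ ^ 2) (l ×ˢ l)
        (𝓝 0) :=
      squeeze_zero (fun _ => by positivity)
        (fun p => norm_gnsVec_sub_sq_le ω hω (hu p.2) (hu p.1)) (by simpa using h2.add h1)
    rw [tendsto_zero_iff_norm_tendsto_zero]
    simpa using h3.sqrt
  have hcom : ∀ a, Tendsto (fun i => gnsVec ω (u i * a - a * u i)) l (𝓝 0) := by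
    intro a
    refine squeeze_zero_norm (fun i => ?_)
      (by simpa using (hcomm a).norm.mul_const ‖gnsVec ω 1‖)
    rw [← gns_gnsVec_one]
    exact norm_gns_apply_le ω _ _
  have hvec : ∀ a, Tendsto (fun p : ι × ι => ω.gnsStarAlgHom (u p.2) (gnsVec ω a) -
      ω.gnsStarAlgHom (u p.1) (gnsVec ω a)) (l ×ˢ l) (𝓝 0) := by
    intro a
    -- The identity behind this: (u_j a - u_i a)Ω = [u_j, a]Ω - [u_i, a]Ω + π(a)(u_j - u_i)Ω.
    have h := (((hcom a).comp tendsto_snd).sub ((hcom a).comp tendsto_fst)).add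
      (((ω.gnsStarAlgHom a).continuous.tendsto 0).comp hΩ)
    simp only [map_zero, sub_zero, add_zero] at h
    refine h.congr fun p => ?_
    simp only [Function.comp_apply, map_sub, gnsVec_sub, gns_gnsVec]
    abel
  rw [Metric.tendsto_nhds]
  intro ε hε
  obtain ⟨a, ha⟩ := Metric.denseRange_iff.1 (denseRange_gnsVec ω) v (ε / 3) (by positivity)
  filter_upwards [Metric.tendsto_nhds.1 (hvec a) (ε / 3) (by positivity)] with p hp
  rw [dist_zero_right] at hp ⊢
  rw [dist_eq_norm] at ha
  have e : ω.gnsStarAlgHom (u p.2) v - ω.gnsStarAlgHom (u p.1) v =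
      (ω.gnsStarAlgHom (u p.2) (gnsVec ω a) - ω.gnsStarAlgHom (u p.1) (gnsVec ω a)) +
      (ω.gnsStarAlgHom (u p.2) (v - gnsVec ω a) - ω.gnsStarAlgHom (u p.1) (v - gnsVec ω a)) := by
    simp only [map_sub]
    abel
  rw [e]
  have h1 := norm_add_le
    (ω.gnsStarAlgHom (u p.2) (gnsVec ω a) - ω.gnsStarAlgHom (u p.1) (gnsVec ω a))
    (ω.gnsStarAlgHom (u p.2) (v - gnsVec ω a) - ω.gnsStarAlgHom (u p.1) (v - gnsVec ω a))
  have h2 := norm_sub_le (ω.gnsStarAlgHom (u p.2) (v - gnsVec ω a))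
    (ω.gnsStarAlgHom (u p.1) (v - gnsVec ω a))
  rw [norm_gns_apply_of_unitary ω (hu _), norm_gns_apply_of_unitary ω (hu _)] at h2
  linarith

theorem exists_tendsto_gns [l.NeBot] (hω : ω 1 = 1) {u : ι → A} (hu : ∀ i, u i ∈ unitary A)
    (hcomm : ∀ a, Tendsto (fun i => u i * a - a * u i) l (𝓝 0))
    (hc : Tendsto (fun p : ι × ι => ω (star (u p.1) * u p.2)) (l ×ˢ l) (𝓝 1)) :
    ∃ U : ω.GNS →L[ℂ] ω.GNS, ∀ v, Tendsto (fun i => ω.gnsStarAlgHom (u i) v) l (𝓝 (U v)) := by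
  choose f hf using fun v => CompleteSpace.complete (cauchy_map_gns hω hu hcomm hc v)
  refine ⟨ContinuousLinearMap.ofTendstoOfBoundedRange (l := l) f
    (fun i => ω.gnsStarAlgHom (u i)) (tendsto_pi_nhds.2 hf) ?_, hf⟩
  refine isBounded_iff_forall_norm_le.2 ⟨1, ?_⟩
  rintro _ ⟨i, rfl⟩
  exact ContinuousLinearMap.opNorm_le_bound _ zero_le_one fun v => by
    rw [norm_gns_apply_of_unitary ω (hu i), one_mul]

/-- Multiplication is not jointly strongly continuous in general; here the left factors are
isometries, so the error u_i(w_i v - W v) has the norm of w_i v - W v. -/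
theorem tendsto_gns_mul {u w : ι → A} (hu : ∀ i, u i ∈ unitary A) {U W : ω.GNS →L[ℂ] ω.GNS}
    (hU : ∀ v, Tendsto (fun i => ω.gnsStarAlgHom (u i) v) l (𝓝 (U v)))
    (hW : ∀ v, Tendsto (fun i => ω.gnsStarAlgHom (w i) v) l (𝓝 (W v))) (v : ω.GNS) :
    Tendsto (fun i => ω.gnsStarAlgHom (u i * w i) v) l (𝓝 ((U * W) v)) := by
  have h1 : Tendsto (fun i => ω.gnsStarAlgHom (u i) (ω.gnsStarAlgHom (w i) v - W v)) l (𝓝 0) := by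
    rw [tendsto_zero_iff_norm_tendsto_zero]
    simp only [norm_gns_apply_of_unitary ω (hu _)]
    simpa using ((hW v).sub_const (W v)).norm
  have h2 := h1.add (hU (W v))
  rw [zero_add] at h2
  refine h2.congr fun i => ?_
  rw [map_sub, sub_add_cancel, map_mul]
  rfl

/-- A strong limit of unitaries need only be an isometry. Convergence of the adjoints supplies the
right inverse that makes it unitary. -/
theorem gns_limit_mem_unitary [l.NeBot] {u : ι → A} (hu : ∀ i, u i ∈ unitary A)
    {U V : ω.GNS →L[ℂ] ω.GNS}
    (hU : ∀ v, Tendsto (fun i => ω.gnsStarAlgHom (u i) v) l (𝓝 (U v)))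
    (hV : ∀ v, Tendsto (fun i => ω.gnsStarAlgHom (star (u i)) v) l (𝓝 (V v))) :
    U ∈ unitary (ω.GNS →L[ℂ] ω.GNS) := by
  have hUV : U * V = 1 := by
    ext v
    refine tendsto_nhds_unique (tendsto_gns_mul hu hU hV v) ?_
    simp only [fun i => Unitary.mul_star_self_of_mem (hu i), map_one]
    exact tendsto_const_nhds
  have hUU : star U * U = 1 := by
    refine (ContinuousLinearMap.norm_map_iff_adjoint_comp_self U).1 fun v => ?_
    refine tendsto_nhds_unique (hU v).norm ?_
    simp only [norm_gns_apply_of_unitary ω (hu _)]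
    exact tendsto_const_nhds
  have hVs : star U = V := by
    rw [← mul_one (star U), ← hUV, ← mul_assoc, hUU, one_mul]
  exact Unitary.mem_iff.2 ⟨hUU, hVs ▸ hUV⟩

theorem gns_limit_mem_centralizer [l.NeBot] {u : ι → A}
    (hcomm : ∀ a, Tendsto (fun i => u i * a - a * u i) l (𝓝 0)) {U : ω.GNS →L[ℂ] ω.GNS}
    (hU : ∀ v, Tendsto (fun i => ω.gnsStarAlgHom (u i) v) l (𝓝 (U v))) :
    U ∈ Set.centralizer (Set.range ω.gnsStarAlgHom) := by
  rintro _ ⟨a, rfl⟩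
  ext v
  have h1 : Tendsto (fun i => ω.gnsStarAlgHom (u i * a - a * u i) v) l (𝓝 0) :=
    squeeze_zero_norm (fun i => norm_gns_apply_le ω _ _)
      (by simpa using (hcomm a).norm.mul_const ‖v‖)
  have h2 := h1.add (((ω.gnsStarAlgHom a).continuous.tendsto _).comp (hU v))
  rw [zero_add] at h2
  refine tendsto_nhds_unique h2 ((hU (ω.gnsStarAlgHom a v)).congr fun i => ?_)
  simp only [map_sub, map_mul, Function.comp_apply, sub_apply]
  exact (sub_add_cancel _ _).symm

/-- A commutant is closed under strong limits, since multiplication by a fixed operator on either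
side is strongly continuous. -/
theorem gns_limit_mem_bicommutant [l.NeBot] {u : ι → A} {U : ω.GNS →L[ℂ] ω.GNS}
    (hU : ∀ v, Tendsto (fun i => ω.gnsStarAlgHom (u i) v) l (𝓝 (U v))) :
    U ∈ Set.centralizer (Set.centralizer (Set.range ω.gnsStarAlgHom)) := by
  intro T hT
  ext v
  refine tendsto_nhds_unique ((T.continuous.tendsto _).comp (hU v)) ((hU (T v)).congr fun i => ?_)
  exact congrArg (fun R => R v) (hT _ ⟨u i, rfl⟩)

/-- The expectation values force U to fix the cyclic vector Ω; since U commutes with π(A), it then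
fixes the dense subspace π(A)Ω. -/
theorem gns_limit_eq_one [l.NeBot] (hω : ω 1 = 1) {u : ι → A} (hu : ∀ i, u i ∈ unitary A)
    {U : ω.GNS →L[ℂ] ω.GNS}
    (hU : ∀ v, Tendsto (fun i => ω.gnsStarAlgHom (u i) v) l (𝓝 (U v)))
    (hUc : U ∈ Set.centralizer (Set.range ω.gnsStarAlgHom))
    (h1 : Tendsto (fun i => ω (u i)) l (𝓝 1)) : U = 1 := by
  have hΩ : U (gnsVec ω 1) = gnsVec ω 1 := by
    refine tendsto_nhds_unique (hU _) ?_
    rw [tendsto_iff_norm_sub_tendsto_zero]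
    have hs : Tendsto (fun i => ‖ω (star (u i)) - 1‖) l (𝓝 0) := by
      simpa [map_star] using (h1.star.sub_const 1).norm
    have hn : Tendsto (fun i => ‖ω (u i) - 1‖) l (𝓝 0) := by
      simpa using (h1.sub_const 1).norm
    have h3 : Tendsto (fun i => ‖gnsVec ω (u i) - gnsVec ω 1‖ ^ 2) l (𝓝 0) := by
      refine squeeze_zero (fun _ => by positivity)
        (fun i => norm_gnsVec_sub_sq_le ω hω (hu i) (one_mem _)) ?_
      simpa using hs.add hn
    simpa only [gns_gnsVec_one, Real.sqrt_sq (norm_nonneg _), Real.sqrt_zero] using h3.sqrt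
  have : (U : ω.GNS → ω.GNS) = id := by
    refine (denseRange_gnsVec ω).equalizer U.continuous continuous_id (funext fun a => ?_)
    change U (gnsVec ω a) = gnsVec ω a
    rw [← gns_gnsVec_one]
    have := congrArg (fun R => R (gnsVec ω 1)) (hUc _ ⟨a, rfl⟩)
    change ω.gnsStarAlgHom a (U (gnsVec ω 1)) = U (ω.gnsStarAlgHom a (gnsVec ω 1)) at this
    rw [← this, hΩ]
  ext v
  exact congrFun this v

end GNS

/-! ### Pauli operators -/

section Pauli

theorem monomialOp_mul {ι : Type*} (e e' : ι ≃ ι) (θ θ' : ι → Circle) :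
    monomialOp e θ * monomialOp e' θ' = monomialOp (e.trans e') (fun i => θ i * θ' (e i)) := by
  ext f i
  change (θ i : ℂ) * ((θ' (e i) : ℂ) * f (e' (e i))) = ((θ i * θ' (e i) : Circle) : ℂ) * f (e' (e i))
  rw [Circle.coe_mul, mul_assoc]

theorem monomialOp_refl_one {ι : Type*} : monomialOp (Equiv.refl ι) 1 = 1 := by
  ext f i
  simp [monomialOp_apply]

theorem norm_monomialOp_apply {ι : Type*} (e : ι ≃ ι) (θ : ι → Circle)
    (f : lp (fun _ : ι => ℂ) 2) : ‖monomialOp e θ f‖ = ‖f‖ := by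
  rw [lp.norm_eq_tsum_rpow (by norm_num), lp.norm_eq_tsum_rpow (by norm_num)]
  congr 1
  rw [← e.tsum_eq fun i => ‖f i‖ ^ (2 : ENNReal).toReal]
  refine tsum_congr fun i => congrArg (· ^ _) ?_
  rw [monomialOp_apply, norm_mul, Circle.norm_coe, one_mul]

/-- For an isometry, a right inverse is the adjoint. This avoids computing adjoints on ℓ² directly.
-/
theorem star_eq_of_mul_eq_one {ι : Type*} {e : ι ≃ ι} {θ : ι → Circle}
    {T : lp (fun _ : ι => ℂ) 2 →L[ℂ] lp (fun _ : ι => ℂ) 2} (h : monomialOp e θ * T = 1) :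
    star (monomialOp e θ) = T := by
  have hs : star (monomialOp e θ) * monomialOp e θ = 1 :=
    (ContinuousLinearMap.norm_map_iff_adjoint_comp_self _).1 (norm_monomialOp_apply e θ)
  rw [← mul_one (star _), ← h, ← mul_assoc, hs, one_mul]

theorem expQZ_add (x y : AddCircle (1 : ℚ)) : expQZ (x + y) = expQZ x * expQZ y := by
  rw [expQZ, map_add, AddCircle.toCircle_add]
  rfl

theorem expQZ_zero : expQZ 0 = 1 := by
  rw [expQZ, map_zero, AddCircle.toCircle_zero]

variable {S : Type u} {G : Type v} [AddCommGroup G]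

theorem quasiLocal_ext {T T' : QuasiLocal S G} (h : T.1 = T'.1) : T = T' := Subtype.ext h

theorem coe_quasiLocal_mul (T T' : QuasiLocal S G) : (T * T').1 = T.1 * T'.1 := rfl

theorem coe_quasiLocal_one : (1 : QuasiLocal S G).1 = 1 := rfl

theorem pauliX_add (a a' : S →₀ G) : pauliX (a + a') = pauliX a * pauliX a' := by
  refine quasiLocal_ext ?_
  rw [coe_quasiLocal_mul]
  change monomialOp _ _ = monomialOp _ _ * monomialOp _ _
  rw [monomialOp_mul]
  congr 1
  · ext σ : 1
    simp [sub_sub]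
  · ext σ
    simp

theorem pauliX_zero : pauliX (0 : S →₀ G) = 1 := by
  refine quasiLocal_ext ?_
  rw [coe_quasiLocal_one, ← monomialOp_refl_one]
  change monomialOp _ _ = monomialOp _ _
  congr 1
  ext σ : 1
  simp

theorem sum_character_add_left (b b' : S →₀ DualGroup G) (σ : S →₀ G) :
    ((b + b').sum fun s χ => χ (σ s)) = (b.sum fun s χ => χ (σ s)) + b'.sum fun s χ => χ (σ s) := by
  classical exact Finsupp.sum_add_index (fun _ _ => rfl) (fun _ _ _ _ => rfl)

theorem sum_character_add_right (b : S →₀ DualGroup G) (σ τ : S →₀ G) :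
    (b.sum fun s χ => χ ((σ + τ) s)) = (b.sum fun s χ => χ (σ s)) + b.sum fun s χ => χ (τ s) := by
  rw [← Finsupp.sum_add]
  simp

theorem pauliZ_add (b b' : S →₀ DualGroup G) : pauliZ (b + b') = pauliZ b * pauliZ b' := by
  refine quasiLocal_ext ?_
  rw [coe_quasiLocal_mul]
  change monomialOp _ _ = monomialOp _ _ * monomialOp _ _
  rw [monomialOp_mul]
  congr 1
  ext σ : 1
  rw [sum_character_add_left, expQZ_add]
  rfl

theorem pauliZ_zero : pauliZ (0 : S →₀ DualGroup G) = 1 := by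
  refine quasiLocal_ext ?_
  rw [coe_quasiLocal_one, ← monomialOp_refl_one]
  change monomialOp _ _ = monomialOp _ _
  congr 1
  ext σ : 1
  rw [Finsupp.sum_zero_index, expQZ_zero]
  rfl

/-- In general the two orders of the product differ by the phase `expQZ` of the pairing of b with a.
-/
theorem pauliX_commute_pauliZ {a : S →₀ G} {b : S →₀ DualGroup G}
    (h : (b.sum fun s χ => χ (a s)) = 0) : Commute (pauliX a) (pauliZ b) := by
  refine quasiLocal_ext ?_
  rw [coe_quasiLocal_mul, coe_quasiLocal_mul]
  change monomialOp _ _ * monomialOp _ _ = monomialOp _ _ * monomialOp _ _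
  rw [monomialOp_mul, monomialOp_mul]
  congr 1
  ext σ : 1
  have := sum_character_add_right b (σ - a) a
  rw [sub_add_cancel, h, add_zero] at this
  change 1 * expQZ (b.sum fun s χ => χ ((σ - a) s)) = expQZ (b.sum fun s χ => χ (σ s)) * 1
  rw [one_mul, mul_one, this]

theorem star_pauliX (a : S →₀ G) : star (pauliX a) = pauliX (-a) := by
  refine quasiLocal_ext (star_eq_of_mul_eq_one ?_)
  have := pauliX_add a (-a)
  rw [add_neg_cancel, pauliX_zero] at this
  exact (congrArg Subtype.val this).symm

theorem star_pauliZ (b : S →₀ DualGroup G) : star (pauliZ b) = pauliZ (-b) := by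
  refine quasiLocal_ext (star_eq_of_mul_eq_one ?_)
  have := pauliZ_add b (-b)
  rw [show b + -b = 0 from add_neg_cancel b, pauliZ_zero] at this
  exact (congrArg Subtype.val this).symm

theorem pauliX_mem_unitary (a : S →₀ G) : pauliX a ∈ unitary (QuasiLocal S G) := by
  rw [Unitary.mem_iff, star_pauliX, ← pauliX_add, ← pauliX_add]
  simp [pauliX_zero]

theorem pauliZ_mem_unitary (b : S →₀ DualGroup G) : pauliZ b ∈ unitary (QuasiLocal S G) := by
  rw [Unitary.mem_iff, star_pauliZ, ← pauliZ_add, ← pauliZ_add,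
    show -b + b = 0 from neg_add_cancel b, show b + -b = 0 from add_neg_cancel b]
  exact ⟨pauliZ_zero, pauliZ_zero⟩

/-! ### Commutation of Pauli operators with local algebras -/

theorem ext_ket {T T' : ConfigSpace S G →L[ℂ] ConfigSpace S G}
    (h : ∀ σ τ : S →₀ G, T (ket τ) σ = T' (ket τ) σ) : T = T' := by
  classical
  refine lp.ext_continuousLinearMap (by norm_num) fun τ => ?_
  refine ContinuousLinearMap.ext_ring ?_
  ext σ
  have := h σ τ
  simp only [ket] at this
  convert! this

theorem pauliX_ket (a τ : S →₀ G) : (pauliX a).1 (ket τ) = ket (τ + a) := by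
  classical
  ext σ
  change ((1 : Circle) : ℂ) * ket τ (σ - a) = _
  rw [ket_apply, ket_apply, Circle.coe_one, one_mul]
  simp only [sub_eq_iff_eq_add]

theorem pauliZ_ket (b : S →₀ DualGroup G) (τ : S →₀ G) :
    (pauliZ b).1 (ket τ) = (expQZ (b.sum fun s χ => χ (τ s)) : ℂ) • ket τ := by
  classical
  ext σ
  change (expQZ (b.sum fun s χ => χ (σ s)) : ℂ) * ket τ σ =
    (expQZ (b.sum fun s χ => χ (τ s)) : ℂ) * ket τ σ
  rw [ket_apply]
  split_ifs with h
  · rw [h]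
  · simp

/-- Shifting by a changes no argument of the matrix M, and shifting both configurations preserves
their agreement outside Λ. -/
theorem pauliX_commute_of_mem_localAlgebra {a : S →₀ G} {Λ : Finset S} (ha : ∀ s ∈ Λ, a s = 0)
    {T : ConfigSpace S G →L[ℂ] ConfigSpace S G} (hT : T ∈ localAlgebra Λ) :
    Commute (pauliX a).1 T := by
  obtain ⟨M, hM⟩ := hT
  refine ext_ket fun σ τ => ?_
  change ((1 : Circle) : ℂ) * T (ket τ) (σ - a) = T ((pauliX a).1 (ket τ)) σ
  rw [pauliX_ket, hM, hM, Circle.coe_one, one_mul]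
  have h1 : (fun s : Λ => (σ - a) s) = fun s : Λ => σ s := by
    ext s
    simp [ha s s.2]
  have h2 : (fun s : Λ => (τ + a) s) = fun s : Λ => τ s := by
    ext s
    simp [ha s s.2]
  rw [h1, h2]
  have h3 : (∀ s ∉ Λ, (σ - a) s = τ s) ↔ ∀ s ∉ Λ, σ s = (τ + a) s :=
    forall₂_congr fun s _ => sub_eq_iff_eq_add
  by_cases h : ∀ s ∉ Λ, (σ - a) s = τ s
  · rw [if_pos h, if_pos (h3.1 h)]
  · rw [if_neg h, if_neg fun h' => h (h3.2 h')]

/-- The phase depends only on sites outside Λ, where configurations joined by a nonzero matrix entry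
of T agree. -/
theorem pauliZ_commute_of_mem_localAlgebra {b : S →₀ DualGroup G} {Λ : Finset S}
    (hb : ∀ s ∈ Λ, b s = 0) {T : ConfigSpace S G →L[ℂ] ConfigSpace S G}
    (hT : T ∈ localAlgebra Λ) : Commute (pauliZ b).1 T := by
  obtain ⟨M, hM⟩ := hT
  refine ext_ket fun σ τ => ?_
  change (expQZ (b.sum fun s χ => χ (σ s)) : ℂ) * T (ket τ) σ = T ((pauliZ b).1 (ket τ)) σ
  rw [pauliZ_ket, map_smul]
  change _ = (expQZ (b.sum fun s χ => χ (τ s)) : ℂ) * T (ket τ) σ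
  rw [hM]
  split_ifs with h
  · congr 3
    refine Finsupp.sum_congr fun s hs => ?_
    rw [h s fun hΛ => Finsupp.mem_support_iff.1 hs (hb s hΛ)]
  · simp

/-- A net of unitaries each of which commutes eventually with every local algebra is
asymptotically central. -/
theorem tendsto_commutator_quasiLocal {ι : Type*} {l : Filter ι} {u : ι → QuasiLocal S G}
    (hu : ∀ i, u i ∈ unitary (QuasiLocal S G))
    (h : ∀ Λ : Finset S, ∀ᶠ i in l, ∀ T ∈ localAlgebra Λ, Commute (u i).1 T)
    (a : QuasiLocal S G) : Tendsto (fun i => u i * a - a * u i) l (𝓝 0) := by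
  have key : ∀ T : ConfigSpace S G →L[ℂ] ConfigSpace S G,
      T ∈ StarAlgebra.adjoin ℂ (⋃ Λ : Finset S, localAlgebra Λ) →
        ∀ᶠ i in l, Commute (u i).1 T := by
    intro T hT
    induction hT using StarAlgebra.adjoin_induction with
    | mem T hT =>
      obtain ⟨Λ, hΛ⟩ := Set.mem_iUnion.1 hT
      exact (h Λ).mono fun i hi => hi T hΛ
    | algebraMap r => exact Eventually.of_forall fun i => (Algebra.commutes r (u i).1).symm
    | add x y _ _ hx hy => filter_upwards [hx, hy] with i h1 h2 using h1.add_right h2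
    | mul x y _ _ hx hy => filter_upwards [hx, hy] with i h1 h2 using h1.mul_right h2
    -- Taking adjoints shows that x* commutes with u*; conjugating by the unitary u turns this into
    -- commutation with u.
    | star x _ hx =>
      filter_upwards [hx] with i hi
      have h1 : (u i).1 * star (u i).1 = 1 :=
        congrArg (fun R : QuasiLocal S G => R.1) (Unitary.mul_star_self_of_mem (hu i))
      have h2 : star (u i).1 * (u i).1 = 1 :=
        congrArg (fun R : QuasiLocal S G => R.1) (Unitary.star_mul_self_of_mem (hu i))
      have h3 : star (u i).1 * star x = star x * star (u i).1 := hi.star_star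
      calc (u i).1 * star x = (u i).1 * star x * (star (u i).1 * (u i).1) := by rw [h2, mul_one]
        _ = (u i).1 * (star x * star (u i).1) * (u i).1 := by simp only [mul_assoc]
        _ = (u i).1 * star (u i).1 * star x * (u i).1 := by rw [← h3]; simp only [mul_assoc]
        _ = star x * (u i).1 := by rw [h1, one_mul]
  rw [Metric.tendsto_nhds]
  intro ε hε
  obtain ⟨T, hT, hTa⟩ := Metric.mem_closure_iff.1 (show a.1 ∈ closure _ from a.2) (ε / 2)
    (by positivity)
  filter_upwards [key T hT] with i hi
  rw [dist_zero_right]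
  let t : QuasiLocal S G := ⟨T, StarSubalgebra.le_topologicalClosure _ hT⟩
  have hit : u i * t = t * u i := quasiLocal_ext hi
  -- Since t commutes with u, only a - t contributes, and each of the two terms has norm at most
  -- ε/2.
  have e : u i * a - a * u i = u i * (a - t) - (a - t) * u i := by
    rw [mul_sub, sub_mul, hit]
    abel
  have h1 := norm_sub_le (u i * (a - t)) ((a - t) * u i)
  rw [CStarRing.norm_mem_unitary_mul _ (hu i), CStarRing.norm_mul_mem_unitary _ (hu i)] at h1
  rw [e]
  have h2 : ‖a - t‖ < ε / 2 := by
    rw [dist_eq_norm] at hTa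
    exact hTa
  linarith

end Pauli

/-! ### Finite chains, truncations and the pairing of boundaries with coboundaries -/

namespace CellularData

variable {K : CellularData.{u}} {M : Type*} [AddCommGroup M]

theorem cobdry_apply_congr {f g : K.Cell → M} {a : K.Cell}
    (h : ∀ b, K.inc a b ≠ 0 → f b = g b) : K.cobdry f a = K.cobdry g a := by
  refine finsum_congr fun b => ?_
  by_cases hb : K.inc a b = 0
  · simp [hb]
  · rw [h b hb]

theorem bdry_apply_congr {f g : K.Cell → M} {b : K.Cell}
    (h : ∀ a, K.inc a b ≠ 0 → f a = g a) : K.bdry f b = K.bdry g b := by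
  refine finsum_congr fun a => ?_
  by_cases ha : K.inc a b = 0
  · simp [ha]
  · rw [h a ha]

theorem finite_support_cobdry_of_finite {f : K.Cell → M} (hf : f.support.Finite) :
    (K.cobdry f).support.Finite := by
  refine (hf.biUnion fun b _ => K.finite_cobdry b).subset fun a ha => ?_
  by_contra h
  refine ha ((cobdry_apply_congr (g := 0) fun b hb => ?_).trans (by simp))
  by_contra hfb
  exact h (Set.mem_biUnion hfb hb)

theorem finite_support_bdry_of_finite {f : K.Cell → M} (hf : f.support.Finite) :
    (K.bdry f).support.Finite := by
  refine (hf.biUnion fun a _ => K.finite_bdry a).subset fun b hb => ?_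
  by_contra h
  refine hb ((bdry_apply_congr (g := 0) fun a ha => ?_).trans (by simp))
  by_contra hfa
  exact h (Set.mem_biUnion hfa ha)

theorem cobdry_mem_finChains {p q : ℤ} (hpq : p + 1 = q) {f : K.Cell → M}
    (hf : f ∈ K.finChains M p) : K.cobdry f ∈ K.finChains M q :=
  hpq ▸ ⟨K.cobdry_mem_infChains hf.1, finite_support_cobdry_of_finite hf.2⟩

theorem bdry_mem_finChains {p q : ℤ} (hpq : q = p + 1) {f : K.Cell → M}
    (hf : f ∈ K.finChains M q) : K.bdry f ∈ K.finChains M p := by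
  subst hpq
  exact ⟨K.bdry_mem_infChains hf.1, finite_support_bdry_of_finite hf.2⟩

theorem truncate_mem_finChains {p : ℤ} (s : Finset (K.cells p)) (f : K.Cell → M) :
    K.truncate s f ∈ K.finChains M p := by
  have h : (K.truncate s f).support ⊆ Subtype.val '' (s : Set (K.cells p)) :=
    Set.support_indicator_subset
  refine ⟨fun a ha => ?_, (s.finite_toSet.image _).subset h⟩
  obtain ⟨b, -, rfl⟩ := h ha
  exact b.2

theorem truncate_add {p : ℤ} (s : Finset (K.cells p)) (f g : K.Cell → M) :
    K.truncate s (f + g) = K.truncate s f + K.truncate s g :=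
  Set.indicator_add' _ f g

/-- A formal sum of `p`-cells agrees on any finite set with all large enough truncations. -/
theorem eventually_truncate_eq {p : ℤ} {f : K.Cell → M} (hf : f ∈ K.infChains M p)
    {F : Set K.Cell} (hF : F.Finite) :
    ∀ᶠ s : Finset (K.cells p) in atTop, ∀ a ∈ F, K.truncate s f a = f a := by
  have hF' : (Subtype.val ⁻¹' F : Set (K.cells p)).Finite :=
    hF.preimage Subtype.val_injective.injOn
  filter_upwards [eventually_ge_atTop hF'.toFinset] with s hs a ha
  -- Cells of F of another dimension can never enter a truncation, but f vanishes there.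
  by_cases h0 : f a = 0
  · rw [truncate, Set.indicator_apply_eq_self.2 fun _ => h0]
  · have hm : (⟨a, hf a h0⟩ : K.cells p) ∈ s := hs (by simpa using ha)
    exact Set.indicator_of_mem (Set.mem_image_of_mem Subtype.val (Finset.mem_coe.2 hm)) f

theorem exists_mem_finChains_eqOn {p : ℤ} {f : K.Cell → M} (hf : f ∈ K.infChains M p)
    {F : Set K.Cell} (hF : F.Finite) : ∃ g ∈ K.finChains M p, ∀ a ∈ F, g a = f a := by
  obtain ⟨s, hs⟩ := (eventually_truncate_eq hf hF).exists
  exact ⟨_, truncate_mem_finChains s f, hs⟩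

/-- A finite cycle of characters pairs trivially with every coboundary. -/
theorem sum_apply_cobdry_eq_zero {G : Type*} [AddCommGroup G] {b : K.Cell → DualGroup G}
    (hb : b.support.Finite) (hb0 : K.bdry b = 0) (c : K.Cell → G) :
    ∑ x ∈ hb.toFinset, b x (K.cobdry c x) = 0 := by
  classical
  set B := hb.toFinset
  set C := B.biUnion fun x => (K.finite_bdry x).toFinset
  have h1 : ∀ x ∈ B, b x (K.cobdry c x) = ∑ y ∈ C, (K.inc x y • b x) (c y) := by
    intro x hx
    have : K.cobdry c x = ∑ y ∈ C, K.inc x y • c y := by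
      refine finsum_eq_sum_of_support_subset _ fun y hy => ?_
      simp only [C, Finset.coe_biUnion, Set.mem_iUnion, Set.Finite.coe_toFinset, Finset.mem_coe]
      exact ⟨x, hx, fun h => hy (by simp [h])⟩
    rw [this, map_sum]
    refine Finset.sum_congr rfl fun y _ => ?_
    rw [map_zsmul]
    rfl
  -- Exchanging the sums moves the coboundary off c: the pairing of b with ∂ᵀc becomes that of ∂b
  -- with c. Finiteness of b makes both sums finite even when c is infinite.
  rw [Finset.sum_congr rfl h1, Finset.sum_comm]
  refine Finset.sum_eq_zero fun y _ => ?_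
  have h2 : K.bdry b y = ∑ x ∈ B, K.inc x y • b x := by
    refine finsum_eq_sum_of_support_subset _ fun x hx => ?_
    simp only [B, Set.Finite.coe_toFinset]
    exact fun h => hx (by simp [h])
  rw [← AddMonoidHom.finsetSum_apply, ← h2, hb0]
  rfl

/-! ### Classes at infinity and their representatives -/

theorem homClass_add (p : ℤ) {d d' : K.Cell → M} (hd : d ∈ K.infChains M (p + 1))
    (hd' : d' ∈ K.infChains M (p + 1)) (fd : (K.bdry d).support.Finite)
    (fd' : (K.bdry d').support.Finite) (fdd : (K.bdry (d + d')).support.Finite) :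
    K.homClass p (d + d') (add_mem hd hd') fdd = K.homClass p d hd fd + K.homClass p d' hd' fd' := by
  refine congrArg QuotientAddGroup.mk (Subtype.ext (Prod.ext ?_ rfl))
  change -K.bdry (d + d') = -K.bdry d + -K.bdry d'
  rw [map_add, neg_add]

theorem cohomClass_add (p : ℤ) {c c' : K.Cell → M} (hc : c ∈ K.infChains M p)
    (hc' : c' ∈ K.infChains M p) (fc : (K.cobdry c).support.Finite)
    (fc' : (K.cobdry c').support.Finite) (fcc : (K.cobdry (c + c')).support.Finite) :
    K.cohomClass p (c + c') (add_mem hc hc') fcc =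
      K.cohomClass p c hc fc + K.cohomClass p c' hc' fc' := by
  refine congrArg QuotientAddGroup.mk (Subtype.ext (Prod.ext ?_ rfl))
  change -K.cobdry (c + c') = -K.cobdry c + -K.cobdry c'
  rw [map_add, neg_add]

/-- The second component of the cycle condition, b + ∂d = 0, determines b. Hence prescribing a map
on the classes of such d determines it everywhere. -/
theorem exists_homClass_eq (p : ℤ) (q : K.HomologyAtInfty M p) :
    ∃ d hd fd, K.homClass p d hd fd = q := by
  obtain ⟨⟨⟨b, d⟩, ⟨⟨hb, hd⟩, hker⟩⟩, rfl⟩ := QuotientAddGroup.mk_surjective q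
  have h : b = -K.bdry d := eq_neg_of_add_eq_zero_left (congrArg Prod.snd hker)
  subst h
  have fd : (K.bdry d).support.Finite := by simpa [Function.support_neg] using hb.2
  exact ⟨d, hd, fd, rfl⟩

theorem exists_cohomClass_eq (p : ℤ) (q : K.CohomologyAtInfty M p) :
    ∃ c hc fc, K.cohomClass p c hc fc = q := by
  obtain ⟨⟨⟨a, c⟩, ⟨⟨ha, hc⟩, hker⟩⟩, rfl⟩ := QuotientAddGroup.mk_surjective q
  have h : a = -K.cobdry c := eq_neg_of_add_eq_zero_left (congrArg Prod.snd hker)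
  subst h
  have fc : (K.cobdry c).support.Finite := by simpa [Function.support_neg] using ha.2
  exact ⟨c, hc, fc, rfl⟩

/-- This reads off the second component of the cone boundary of (b, e); the first is not needed. -/
theorem exists_of_homClass_eq {p : ℤ} {d d' : K.Cell → M} {hd : d ∈ K.infChains M (p + 1)}
    {hd' : d' ∈ K.infChains M (p + 1)} {fd : (K.bdry d).support.Finite}
    {fd' : (K.bdry d').support.Finite} (h : K.homClass p d hd fd = K.homClass p d' hd' fd') :
    ∃ b ∈ K.finChains M (p + 1), ∃ e ∈ K.infChains M (p + 1 + 1), d' - d = b + K.bdry e := by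
  obtain ⟨⟨b, e⟩, ⟨hb, he⟩, hy⟩ := QuotientAddGroup.eq.1 h
  refine ⟨b, hb, e, he, ?_⟩
  rw [sub_eq_neg_add]
  exact (congrArg Prod.snd hy).symm

theorem exists_of_cohomClass_eq {p : ℤ} {c c' : K.Cell → M} {hc : c ∈ K.infChains M p}
    {hc' : c' ∈ K.infChains M p} {fc : (K.cobdry c).support.Finite}
    {fc' : (K.cobdry c').support.Finite}
    (h : K.cohomClass p c hc fc = K.cohomClass p c' hc' fc') :
    ∃ a ∈ K.finChains M p, ∃ f ∈ K.infChains M (p - 1), c' - c = a + K.cobdry f := by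
  obtain ⟨⟨a, f⟩, ⟨ha, hf⟩, hy⟩ := QuotientAddGroup.eq.1 h
  refine ⟨a, by simpa using ha, f, hf, ?_⟩
  rw [sub_eq_neg_add]
  exact (congrArg Prod.snd hy).symm

end CellularData

open CellularData

/-! ### Truncated polarization operators -/

section Polarization

variable {K : CellularData.{u}} {G : Type v} [AddCommGroup G] {n : ℕ}

theorem toFinsupp_apply {S M : Type*} [AddCommGroup M] {f : S → M} (hf : f.support.Finite)
    (s : S) : toFinsupp f s = f s := by
  rw [toFinsupp, dif_pos hf]
  rfl

theorem toFinsupp_add {S M : Type*} [AddCommGroup M] {f g : S → M} (hf : f.support.Finite)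
    (hg : g.support.Finite) : toFinsupp (f + g) = toFinsupp f + toFinsupp g := by
  ext s
  rw [Finsupp.add_apply, toFinsupp_apply hf, toFinsupp_apply hg,
    toFinsupp_apply (f := f + g) ((hf.union hg).subset (Function.support_add f g)), Pi.add_apply]

theorem finite_support_cells {M : Type*} [Zero M] {p : ℤ} {f : K.Cell → M}
    (hf : f.support.Finite) : (fun s : K.cells p => f s).support.Finite :=
  hf.preimage Subtype.val_injective.injOn

theorem opX_add {a a' : K.Cell → G} (ha : a.support.Finite) (ha' : a'.support.Finite) :
    opX n (a + a') = opX n a * opX n a' :=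
  (congrArg pauliX (toFinsupp_add (finite_support_cells ha) (finite_support_cells ha'))).trans
    (pauliX_add _ _)

theorem opZ_add {b b' : K.Cell → DualGroup G} (hb : b.support.Finite) (hb' : b'.support.Finite) :
    opZ n (b + b') = opZ n b * opZ n b' :=
  (congrArg pauliZ (toFinsupp_add (finite_support_cells hb) (finite_support_cells hb'))).trans
    (pauliZ_add _ _)

/-- The commutation phase is the pairing of the finite cycle ∂d with a coboundary. -/
theorem opX_cobdry_commute_opZ_bdry {c : K.Cell → G} {d : K.Cell → DualGroup G}
    (hd : d ∈ K.infChains (DualGroup G) (n + 1)) (fc : (K.cobdry c).support.Finite)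
    (fd : (K.bdry d).support.Finite) : Commute (opX n (K.cobdry c)) (opZ n (K.bdry d)) := by
  classical
  refine pauliX_commute_pauliZ ?_
  rw [← sum_apply_cobdry_eq_zero fd (K.bdry_bdry d) c]
  -- As ∂d is supported on n-cells, summing over all cells is the same as summing over the sites.
  have hs : fd.toFinset = (toFinsupp fun s : K.cells n => K.bdry d s).support.map
      (Function.Embedding.subtype _) := by
    ext x
    simp only [Set.Finite.mem_toFinset, Finset.mem_map, Finsupp.mem_support_iff,
      toFinsupp_apply (finite_support_cells fd)]
    constructor
    · exact fun hx => ⟨⟨x, K.bdry_mem_infChains hd x hx⟩, hx, rfl⟩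
    · rintro ⟨s, h, rfl⟩
      exact h
  rw [hs, Finset.sum_map]
  refine Finset.sum_congr rfl fun s _ => ?_
  rw [toFinsupp_apply (finite_support_cells fd)]
  exact congrArg (fun g => K.bdry d s.1 g) (toFinsupp_apply (finite_support_cells fc) s)

variable (K G n) in
/-- The pairs `(c, d)` of an `(n-1)`-cochain with finite coboundary and a locally finite
`(n+1)`-chain with finite boundary. -/
def fluxPairs : AddSubgroup ((K.Cell → G) × (K.Cell → DualGroup G)) where
  carrier := {x | x.1 ∈ K.infChains G (n - 1) ∧ x.2 ∈ K.infChains (DualGroup G) (n + 1) ∧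
    (K.cobdry x.1).support.Finite ∧ (K.bdry x.2).support.Finite}
  zero_mem' := ⟨zero_mem _, zero_mem _, by simp, by simp⟩
  add_mem' {x y} hx hy := by
    refine ⟨add_mem hx.1 hy.1, add_mem hx.2.1 hy.2.1, ?_, ?_⟩
    · rw [Prod.fst_add, map_add]
      exact (hx.2.2.1.union hy.2.2.1).subset (Function.support_add _ _)
    · rw [Prod.snd_add, map_add]
      exact (hx.2.2.2.union hy.2.2.2).subset (Function.support_add _ _)
  neg_mem' {x} hx := by
    refine ⟨neg_mem hx.1, neg_mem hx.2.1, ?_, ?_⟩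
    · rw [Prod.fst_neg, map_neg, Function.support_neg]
      exact hx.2.2.1
    · rw [Prod.snd_neg, map_neg, Function.support_neg]
      exact hx.2.2.2

theorem mem_fluxPairs_of_finChains {x : (K.Cell → G) × (K.Cell → DualGroup G)}
    (h1 : x.1 ∈ K.finChains G (n - 1)) (h2 : x.2 ∈ K.finChains (DualGroup G) (n + 1)) :
    x ∈ fluxPairs K G n :=
  ⟨h1.1, h2.1, finite_support_cobdry_of_finite h1.2, finite_support_bdry_of_finite h2.2⟩

variable (n) in
/-- The operator `X^{∂ᵀc} Z^{∂d}`. -/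
def fluxOp (x : (K.Cell → G) × (K.Cell → DualGroup G)) : ModelAlgebra K G n :=
  opX n (K.cobdry x.1) * opZ n (K.bdry x.2)

theorem fluxOp_mem_unitary (x : (K.Cell → G) × (K.Cell → DualGroup G)) :
    fluxOp n x ∈ unitary (ModelAlgebra K G n) :=
  mul_mem (pauliX_mem_unitary _) (pauliZ_mem_unitary _)

/-- The Z factor of x has to pass the X factor of y, which it does without a phase. -/
theorem fluxOp_add {x y : (K.Cell → G) × (K.Cell → DualGroup G)} (hx : x ∈ fluxPairs K G n)
    (hy : y ∈ fluxPairs K G n) : fluxOp n (x + y) = fluxOp n x * fluxOp n y := by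
  have h := opX_cobdry_commute_opZ_bdry hx.2.1 hy.2.2.1 hx.2.2.2
  rw [fluxOp, Prod.fst_add, Prod.snd_add, map_add, map_add, opX_add hx.2.2.1 hy.2.2.1,
    opZ_add hx.2.2.2 hy.2.2.2]
  exact h.mul_mul_mul_comm _ _

theorem fluxOp_zero : fluxOp n (0 : (K.Cell → G) × (K.Cell → DualGroup G)) = 1 := by
  have h := fluxOp_add (zero_mem (fluxPairs K G n)) (zero_mem (fluxPairs K G n))
  rw [add_zero] at h
  have hu := Unitary.star_mul_self_of_mem (fluxOp_mem_unitary (n := n)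
    (0 : (K.Cell → G) × (K.Cell → DualGroup G)))
  rw [← one_mul (fluxOp n 0), ← hu, mul_assoc, ← h]

theorem star_fluxOp {x : (K.Cell → G) × (K.Cell → DualGroup G)} (hx : x ∈ fluxPairs K G n) :
    star (fluxOp n x) = fluxOp n (-x) := by
  rw [← mul_one (star _), ← fluxOp_zero, ← add_neg_cancel x, fluxOp_add hx (neg_mem hx),
    ← mul_assoc, Unitary.star_mul_self_of_mem (fluxOp_mem_unitary x), one_mul]

variable (n) in
/-- The pair `(c - c_{K₋}, d - d_{K₊})`. -/
def tail (k : Finset (K.cells (n - 1)) × Finset (K.cells (n + 1))) :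
    (K.Cell → G) × (K.Cell → DualGroup G) →+ (K.Cell → G) × (K.Cell → DualGroup G) where
  toFun x := (x.1 - K.truncate k.1 x.1, x.2 - K.truncate k.2 x.2)
  map_zero' := by
    have h (M : Type v) [AddCommGroup M] {p : ℤ} (s : Finset (K.cells p)) :
        K.truncate s (0 : K.Cell → M) = 0 := Set.indicator_zero' _
    simp [h]
  map_add' x y := by
    ext1
    · change x.1 + y.1 - K.truncate k.1 (x.1 + y.1) = _
      rw [truncate_add]
      exact add_sub_add_comm _ _ _ _
    · change x.2 + y.2 - K.truncate k.2 (x.2 + y.2) = _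
      rw [truncate_add]
      exact add_sub_add_comm _ _ _ _

theorem tail_mem_fluxPairs (k : Finset (K.cells (n - 1)) × Finset (K.cells (n + 1)))
    {x : (K.Cell → G) × (K.Cell → DualGroup G)} (hx : x ∈ fluxPairs K G n) :
    tail n k x ∈ fluxPairs K G n :=
  sub_mem hx (mem_fluxPairs_of_finChains (x := (K.truncate k.1 x.1, K.truncate k.2 x.2))
    (truncate_mem_finChains _ _) (truncate_mem_finChains _ _))

theorem eventually_tail_eq_zero {x : (K.Cell → G) × (K.Cell → DualGroup G)}
    (hx : x ∈ fluxPairs K G n) {F F' : Set K.Cell} (hF : F.Finite) (hF' : F'.Finite) :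
    ∀ᶠ k : Finset (K.cells (n - 1)) × Finset (K.cells (n + 1)) in atTop,
      (∀ a ∈ F, (tail n k x).1 a = 0) ∧ ∀ a ∈ F', (tail n k x).2 a = 0 := by
  rw [← prod_atTop_atTop_eq]
  filter_upwards [tendsto_fst.eventually (eventually_truncate_eq hx.1 hF),
    tendsto_snd.eventually (eventually_truncate_eq hx.2.1 hF')] with k h1 h2
  exact ⟨fun a ha => sub_eq_zero.2 (h1 a ha).symm, fun a ha => sub_eq_zero.2 (h2 a ha).symm⟩

/-- Only finitely many (n-1)- and (n+1)-cells are incident to the sites of Λ. Once the tail vanishes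
on them, both Pauli factors act trivially on Λ. -/
theorem tendsto_commutator_fluxOp_tail {x : (K.Cell → G) × (K.Cell → DualGroup G)}
    (hx : x ∈ fluxPairs K G n) (a : ModelAlgebra K G n) :
    Tendsto (fun k => fluxOp n (tail n k x) * a - a * fluxOp n (tail n k x)) atTop (𝓝 0) := by
  refine tendsto_commutator_quasiLocal (fun k => fluxOp_mem_unitary _) (fun Λ => ?_) a
  have hF : (⋃ s ∈ Λ, {b | K.inc s.1 b ≠ 0}).Finite :=
    Λ.finite_toSet.biUnion fun s _ => K.finite_bdry s
  have hF' : (⋃ s ∈ Λ, {b | K.inc b s.1 ≠ 0}).Finite :=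
    Λ.finite_toSet.biUnion fun s _ => K.finite_cobdry s
  filter_upwards [eventually_tail_eq_zero hx hF hF'] with k hk T hT
  have hm := tail_mem_fluxPairs k hx
  refine Commute.mul_left (pauliX_commute_of_mem_localAlgebra (fun s hs => ?_) hT)
    (pauliZ_commute_of_mem_localAlgebra (fun s hs => ?_) hT)
  · rw [toFinsupp_apply (finite_support_cells hm.2.2.1)]
    refine (cobdry_apply_congr (g := 0) fun b hb => ?_).trans (by simp)
    exact hk.1 b (Set.mem_biUnion hs hb)
  · rw [toFinsupp_apply (finite_support_cells hm.2.2.2)]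
    refine (bdry_apply_congr (g := 0) fun b hb => ?_).trans (by simp)
    exact hk.2 b (Set.mem_biUnion hs hb)

/-! ### Expectation values of the truncated operators -/

variable {ω : ModelAlgebra K G n →ₚ[ℂ] ℂ}

/-- The infinite parts of two tails cancel in their difference, leaving a finite pair that vanishes
on K±(ε), to which the ground state condition applies. -/
theorem tendsto_state_fluxOp_tail (hω : IsAsymptoticGroundState ω)
    {x : (K.Cell → G) × (K.Cell → DualGroup G)} (hx : x ∈ fluxPairs K G n) :
    Tendsto (fun p : (Finset (K.cells (n - 1)) × Finset (K.cells (n + 1))) ×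
      (Finset (K.cells (n - 1)) × Finset (K.cells (n + 1))) =>
        ω (star (fluxOp n (tail n p.1 x)) * fluxOp n (tail n p.2 x))) (atTop ×ˢ atTop) (𝓝 1) := by
  rw [Metric.tendsto_nhds]
  intro ε hε
  obtain ⟨Km, Kp, hK⟩ := hω.2 ε hε
  have h := eventually_tail_eq_zero hx (Km.finite_toSet.image Subtype.val)
    (Kp.finite_toSet.image Subtype.val)
  filter_upwards [tendsto_fst.eventually h, tendsto_snd.eventually h] with p h1 h2
  rw [star_fluxOp (tail_mem_fluxPairs _ hx), ← fluxOp_add (neg_mem (tail_mem_fluxPairs _ hx))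
    (tail_mem_fluxPairs _ hx), dist_eq_norm]
  refine hK _ ?_ _ ?_ (fun α hα => ?_) fun β hβ => ?_
  · have e : (-tail n p.1 x + tail n p.2 x).1 = K.truncate p.1.1 x.1 - K.truncate p.2.1 x.1 := by
      change -(x.1 - K.truncate p.1.1 x.1) + (x.1 - K.truncate p.2.1 x.1) = _
      abel
    rw [e]
    exact sub_mem (truncate_mem_finChains _ _) (truncate_mem_finChains _ _)
  · have e : (-tail n p.1 x + tail n p.2 x).2 = K.truncate p.1.2 x.2 - K.truncate p.2.2 x.2 := by
      change -(x.2 - K.truncate p.1.2 x.2) + (x.2 - K.truncate p.2.2 x.2) = _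
      abel
    rw [e]
    exact sub_mem (truncate_mem_finChains _ _) (truncate_mem_finChains _ _)
  · change -(tail n p.1 x).1 α + (tail n p.2 x).1 α = 0
    rw [h1.1 _ ⟨α, hα, rfl⟩, h2.1 _ ⟨α, hα, rfl⟩, neg_zero, add_zero]
  · change -(tail n p.1 x).2 β + (tail n p.2 x).2 β = 0
    rw [h1.2 _ ⟨β, hβ, rfl⟩, h2.2 _ ⟨β, hβ, rfl⟩, neg_zero, add_zero]

/-- For a pair which is a boundary at infinity, the truncated operators have expectation value
tending to one. -/
theorem tendsto_state_fluxOp_tail_of_boundary (hω : IsAsymptoticGroundState ω)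
    {x : (K.Cell → G) × (K.Cell → DualGroup G)} (hx : x ∈ fluxPairs K G n)
    {a f : K.Cell → G} (ha : a ∈ K.finChains G (n - 1)) (hf : f ∈ K.infChains G (n - 1 - 1))
    (hxa : x.1 = a + K.cobdry f) {b e : K.Cell → DualGroup G}
    (hb : b ∈ K.finChains (DualGroup G) (n + 1))
    (he : e ∈ K.infChains (DualGroup G) (n + 1 + 1)) (hxb : x.2 = b + K.bdry e) :
    Tendsto (fun k => ω (fluxOp n (tail n k x))) atTop (𝓝 1) := by
  rw [Metric.tendsto_nhds]
  intro ε hε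
  obtain ⟨Km, Kp, hK⟩ := hω.2 ε hε
  -- The condition on ω only admits finite chains. So f is replaced by a finite f' that agrees with
  -- it on all cells entering ∂ᵀf over `Km`, and likewise e over `Kp`.
  obtain ⟨f', hf', hff⟩ := exists_mem_finChains_eqOn hf
    (Km.finite_toSet.biUnion fun α _ => K.finite_bdry α.1)
  obtain ⟨e', he', hee⟩ := exists_mem_finChains_eqOn he
    (Kp.finite_toSet.biUnion fun β _ => K.finite_cobdry β.1)
  filter_upwards [eventually_tail_eq_zero hx (Km.finite_toSet.image Subtype.val)
    (Kp.finite_toSet.image Subtype.val)] with k hk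
  -- The operator is unchanged, since ∂ᵀ kills both ∂ᵀf and ∂ᵀf'.
  have e1 : K.cobdry (tail n k x).1 = K.cobdry (a + K.cobdry f' - K.truncate k.1 x.1) := by
    change K.cobdry (x.1 - _) = _
    rw [map_sub, map_sub, map_add, cobdry_cobdry]
    nth_rw 1 [hxa]
    rw [map_add, cobdry_cobdry]
  have e2 : K.bdry (tail n k x).2 = K.bdry (b + K.bdry e' - K.truncate k.2 x.2) := by
    change K.bdry (x.2 - _) = _
    rw [map_sub, map_sub, map_add, bdry_bdry]
    nth_rw 1 [hxb]
    rw [map_add, bdry_bdry]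
  rw [dist_eq_norm, fluxOp, e1, e2]
  refine hK _ ?_ _ ?_ (fun α hα => ?_) fun β hβ => ?_
  · exact sub_mem (add_mem ha (cobdry_mem_finChains (by ring) hf')) (truncate_mem_finChains _ _)
  · exact sub_mem (add_mem hb (bdry_mem_finChains rfl he')) (truncate_mem_finChains _ _)
  · refine Eq.trans ?_ (hk.1 α ⟨α, hα, rfl⟩)
    have h : K.cobdry f' α = K.cobdry f α :=
      cobdry_apply_congr fun γ hγ => hff γ (Set.mem_biUnion hα hγ)
    change a α + K.cobdry f' α - _ = x.1 α - _
    rw [h, congrFun hxa α]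
    rfl
  · refine Eq.trans ?_ (hk.2 β ⟨β, hβ, rfl⟩)
    have h : K.bdry e' β = K.bdry e β :=
      bdry_apply_congr fun γ hγ => hee γ (Set.mem_biUnion hβ hγ)
    change b β + K.bdry e' β - _ = x.2 β - _
    rw [h, congrFun hxb β]
    rfl

instance atTop_finset_prod_neBot {α β : Type*} : (atTop : Filter (Finset α × Finset β)).NeBot := by
  rw [← prod_atTop_atTop_eq]
  infer_instance

/-! ### Polarization operators in the GNS representation -/

theorem IsPolarizationLimit.eq {c : K.Cell → G} {d : K.Cell → DualGroup G}
    {U V : ω.GNS →L[ℂ] ω.GNS} (hU : IsPolarizationLimit ω c d U)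
    (hV : IsPolarizationLimit ω c d V) : U = V :=
  ContinuousLinearMap.ext fun v => tendsto_nhds_unique (hU v) (hV v)

theorem IsPolarizationLimit.mem_gnsCenter {x : (K.Cell → G) × (K.Cell → DualGroup G)}
    (hx : x ∈ fluxPairs K G n) {U : ω.GNS →L[ℂ] ω.GNS} (hU : IsPolarizationLimit ω x.1 x.2 U) :
    U ∈ gnsCenter ω :=
  ⟨gns_limit_mem_centralizer (u := fun k => fluxOp n (tail n k x))
    (tendsto_commutator_fluxOp_tail hx) hU,
    gns_limit_mem_bicommutant (u := fun k => fluxOp n (tail n k x)) hU⟩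

/-- Unitarity comes from applying the existence of limits to -x as well, whose operators are the
adjoints of those of x. -/
theorem exists_isPolarizationLimit (hω : IsAsymptoticGroundState ω)
    {x : (K.Cell → G) × (K.Cell → DualGroup G)} (hx : x ∈ fluxPairs K G n) :
    ∃ U ∈ unitary (ω.GNS →L[ℂ] ω.GNS), IsPolarizationLimit ω x.1 x.2 U ∧ U ∈ gnsCenter ω := by
  have key : ∀ {y}, y ∈ fluxPairs K G n → ∃ U, IsPolarizationLimit ω y.1 y.2 U := fun {y} hy =>
    exists_tendsto_gns (u := fun k => fluxOp n (tail n k y)) hω.1 (fun _ => fluxOp_mem_unitary _)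
      (tendsto_commutator_fluxOp_tail hy) (tendsto_state_fluxOp_tail hω hy)
  obtain ⟨U, hU⟩ := key hx
  obtain ⟨V, hV⟩ := key (neg_mem hx)
  refine ⟨U, gns_limit_mem_unitary (u := fun k => fluxOp n (tail n k x)) (V := V)
    (fun _ => fluxOp_mem_unitary _) hU fun v => ?_, hU, hU.mem_gnsCenter hx⟩
  refine (hV v).congr fun k => ?_
  rw [star_fluxOp (tail_mem_fluxPairs k hx), ← map_neg]
  rfl

theorem IsPolarizationLimit.mul {x y : (K.Cell → G) × (K.Cell → DualGroup G)}
    (hx : x ∈ fluxPairs K G n) (hy : y ∈ fluxPairs K G n) {U V : ω.GNS →L[ℂ] ω.GNS}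
    (hU : IsPolarizationLimit ω x.1 x.2 U) (hV : IsPolarizationLimit ω y.1 y.2 V) :
    IsPolarizationLimit ω (x + y).1 (x + y).2 (U * V) := by
  intro v
  refine (tendsto_gns_mul (u := fun k => fluxOp n (tail n k x)) (w := fun k => fluxOp n (tail n k y))
    (fun _ => fluxOp_mem_unitary _) hU hV v).congr fun k => ?_
  rw [← fluxOp_add (tail_mem_fluxPairs k hx) (tail_mem_fluxPairs k hy), ← map_add]
  rfl

/-- The difference y - x is a boundary at infinity, so its limit W is 1, and the limit of y is W
times that of x. -/
theorem IsPolarizationLimit.eq_of_class_eq (hω : IsAsymptoticGroundState ω)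
    {x y : (K.Cell → G) × (K.Cell → DualGroup G)} (hx : x ∈ fluxPairs K G n)
    (hy : y ∈ fluxPairs K G n)
    (hd : K.homClass n x.2 hx.2.1 hx.2.2.2 = K.homClass n y.2 hy.2.1 hy.2.2.2)
    (hc : K.cohomClass (n - 1) x.1 hx.1 hx.2.2.1 = K.cohomClass (n - 1) y.1 hy.1 hy.2.2.1)
    {U V : ω.GNS →L[ℂ] ω.GNS} (hU : IsPolarizationLimit ω x.1 x.2 U)
    (hV : IsPolarizationLimit ω y.1 y.2 V) : U = V := by
  obtain ⟨a, ha, f, hf, hxa⟩ := exists_of_cohomClass_eq hc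
  obtain ⟨b, hb, e, he, hxb⟩ := exists_of_homClass_eq hd
  have hyx : y - x ∈ fluxPairs K G n := sub_mem hy hx
  obtain ⟨W, -, hW, hWc⟩ := exists_isPolarizationLimit hω hyx
  have hW1 : W = 1 := gns_limit_eq_one (u := fun k => fluxOp n (tail n k (y - x))) hω.1
    (fun _ => fluxOp_mem_unitary _) hW hWc.1
    (tendsto_state_fluxOp_tail_of_boundary hω hyx ha hf hxa hb he hxb)
  have h := hW.mul hyx hx hU
  rw [sub_add_cancel, hW1, one_mul] at h
  exact h.eq hV

/-! ### The representation of the groups at infinity -/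

variable (K G n) in
/-- The class at infinity of a pair in `fluxPairs`. -/
def fluxClass (x : fluxPairs K G n) :
    K.HomologyAtInfty (DualGroup G) n × K.CohomologyAtInfty G (n - 1) :=
  (K.homClass n x.1.2 x.2.2.1 x.2.2.2.2, K.cohomClass (n - 1) x.1.1 x.2.1 x.2.2.2.1)

theorem fluxClass_add (x y : fluxPairs K G n) :
    fluxClass K G n (x + y) = fluxClass K G n x + fluxClass K G n y :=
  Prod.ext (homClass_add _ x.2.2.1 y.2.2.1 x.2.2.2.2 y.2.2.2.2 (x + y).2.2.2.2)
    (cohomClass_add _ x.2.1 y.2.1 x.2.2.2.1 y.2.2.2.1 (x + y).2.2.2.1)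

theorem fluxClass_surjective : Function.Surjective (fluxClass K G n) := by
  rintro ⟨q, r⟩
  obtain ⟨d, hd, fd, rfl⟩ := exists_homClass_eq _ q
  obtain ⟨c, hc, fc, rfl⟩ := exists_cohomClass_eq _ r
  exact ⟨⟨(c, d), hc, hd, fc, fd⟩, rfl⟩

theorem IsPolarizationLimit.eq_of_fluxClass_eq (hω : IsAsymptoticGroundState ω)
    {x y : fluxPairs K G n} (h : fluxClass K G n x = fluxClass K G n y)
    {U V : ω.GNS →L[ℂ] ω.GNS} (hU : IsPolarizationLimit ω x.1.1 x.1.2 U)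
    (hV : IsPolarizationLimit ω y.1.1 y.1.2 V) : U = V :=
  hU.eq_of_class_eq hω x.2 y.2 (congrArg Prod.fst h) (congrArg Prod.snd h) hV

/-- The unitary representation of the groups at infinity by polarization operators. -/
theorem exists_polarizationRep (hω : IsAsymptoticGroundState ω) :
    ∃ P : Multiplicative (K.HomologyAtInfty (DualGroup G) n × K.CohomologyAtInfty G (n - 1)) →*
        unitary (ω.GNS →L[ℂ] ω.GNS),
      ∀ x : fluxPairs K G n, IsPolarizationLimit ω x.1.1 x.1.2
        (P (Multiplicative.ofAdd (fluxClass K G n x)) : ω.GNS →L[ℂ] ω.GNS) := by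
  choose U hU using fun x : fluxPairs K G n => exists_isPolarizationLimit hω x.2
  -- The section r of the class map is not additive; multiplicativity holds because the limit
  -- depends only on the class.
  choose r hr using fluxClass_surjective (K := K) (G := G) (n := n)
  refine ⟨MonoidHom.mk' (fun q => ⟨U (r q.toAdd), (hU _).1⟩) fun p q => Subtype.ext ?_,
    fun x => ?_⟩
  · refine IsPolarizationLimit.eq_of_fluxClass_eq hω (y := r p.toAdd + r q.toAdd) ?_ (hU _).2.1
      ((hU (r p.toAdd)).2.1.mul (r p.toAdd).2 (r q.toAdd).2 (hU (r q.toAdd)).2.1)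
    rw [fluxClass_add, hr, hr, hr, toAdd_mul]
  · have : U (r (fluxClass K G n x)) = U x :=
      IsPolarizationLimit.eq_of_fluxClass_eq hω (hr _) (hU _).2.1 (hU x).2.1
    change IsPolarizationLimit ω x.1.1 x.1.2 (U (r (fluxClass K G n x)))
    rw [this]
    exact (hU x).2.1

end Polarization

end CellKitaev

end

theorem theorem7p4 {X : Type u} [TopologicalSpace X] [T2Space X] (E : Set X)
    [Topology.CWComplex E] (o : CellOrientation E) (hfin : IsLocallyFinite o)
    (G : Type v) [AddCommGroup G] [Finite G] (n : ℕ)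
    (ω : ModelAlgebra (cellularData o hfin) G n →ₚ[ℂ] ℂ) (hω : IsAsymptoticGroundState ω) :
    -- the strong limit exists, is unitary, and is central
    (∀ (c : (cellularData o hfin).Cell → G) (d : (cellularData o hfin).Cell → DualGroup G),
      c ∈ (cellularData o hfin).infChains G (n - 1) →
      d ∈ (cellularData o hfin).infChains (DualGroup G) (n + 1) →
      ((cellularData o hfin).cobdry c).support.Finite →
      ((cellularData o hfin).bdry d).support.Finite →
      ∃ U ∈ unitary (ω.GNS →L[ℂ] ω.GNS), IsPolarizationLimit ω c d U ∧ U ∈ gnsCenter ω) ∧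
    -- the limit depends only on the classes at infinity
    (∀ (c c' : (cellularData o hfin).Cell → G) (d d' : (cellularData o hfin).Cell → DualGroup G)
      (hc : c ∈ (cellularData o hfin).infChains G (n - 1))
      (hc' : c' ∈ (cellularData o hfin).infChains G (n - 1))
      (hd : d ∈ (cellularData o hfin).infChains (DualGroup G) (n + 1))
      (hd' : d' ∈ (cellularData o hfin).infChains (DualGroup G) (n + 1))
      (fc : ((cellularData o hfin).cobdry c).support.Finite)
      (fc' : ((cellularData o hfin).cobdry c').support.Finite)
      (fd : ((cellularData o hfin).bdry d).support.Finite)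
      (fd' : ((cellularData o hfin).bdry d').support.Finite),
      (cellularData o hfin).homClass n d hd fd = (cellularData o hfin).homClass n d' hd' fd' →
      (cellularData o hfin).cohomClass (n - 1) c hc fc =
        (cellularData o hfin).cohomClass (n - 1) c' hc' fc' →
      ∀ U U' : ω.GNS →L[ℂ] ω.GNS,
        IsPolarizationLimit ω c d U → IsPolarizationLimit ω c' d' U' → U = U') ∧
    -- the limits form a unitary representation of the groups at infinity
    ∃! P : Multiplicative ((cellularData o hfin).HomologyAtInfty (DualGroup G) n ×
        (cellularData o hfin).CohomologyAtInfty G (n - 1)) →* unitary (ω.GNS →L[ℂ] ω.GNS),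
      (∀ x, (P x : ω.GNS →L[ℂ] ω.GNS) ∈ gnsCenter ω) ∧
      ∀ (c : (cellularData o hfin).Cell → G) (d : (cellularData o hfin).Cell → DualGroup G)
        (hc : c ∈ (cellularData o hfin).infChains G (n - 1))
        (hd : d ∈ (cellularData o hfin).infChains (DualGroup G) (n + 1))
        (fc : ((cellularData o hfin).cobdry c).support.Finite)
        (fd : ((cellularData o hfin).bdry d).support.Finite),
        IsPolarizationLimit ω c d
          (P (Multiplicative.ofAdd ((cellularData o hfin).homClass n d hd fd,
            (cellularData o hfin).cohomClass (n - 1) c hc fc)) : ω.GNS →L[ℂ] ω.GNS) := by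
  refine ⟨fun c d hc hd fc fd => ?_, fun c c' d d' hc hc' hd hd' fc fc' fd fd' h h' U U' hU hU' => ?_,
    ?_⟩
  · exact exists_isPolarizationLimit (x := (c, d)) hω ⟨hc, hd, fc, fd⟩
  · exact IsPolarizationLimit.eq_of_class_eq (x := (c, d)) (y := (c', d')) hω ⟨hc, hd, fc, fd⟩
      ⟨hc', hd', fc', fd'⟩ h h' hU hU'
  · obtain ⟨P, hP⟩ := exists_polarizationRep hω
    refine ⟨P, ⟨fun q => ?_, fun c d hc hd fc fd => hP ⟨(c, d), hc, hd, fc, fd⟩⟩, fun Q hQ => ?_⟩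
    · obtain ⟨x, hx⟩ := fluxClass_surjective q.toAdd
      have h := (hP x).mem_gnsCenter x.2
      rwa [hx] at h
    -- Uniqueness: every pair of classes has a representative (c, d), and strong limits along the
    -- net are unique.
    · refine MonoidHom.ext fun q => ?_
      obtain ⟨x, hx⟩ := fluxClass_surjective q.toAdd
      have h := (hQ.2 x.1.1 x.1.2 x.2.1 x.2.2.1 x.2.2.2.1 x.2.2.2.2).eq (hP x)
      change (Q (Multiplicative.ofAdd (fluxClass _ G n x)) : ω.GNS →L[ℂ] ω.GNS) = _ at h
      rw [hx] at h
      exact Subtype.ext h
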